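/- Let $|\alpha|\le 1$ and $P>0$. Consider the additive Gaussian noise channel $Y_i=X_i+Z_i$, $i=1,2,\dots$, with noiseless causal feedback, where $Z_i=\alpha U_{i-1}+U_i$ and $U_0,U_1,\dots$ are i.i.d. $N(0,1)$. For $R\in\mathbb{R}$, a $(2^{nR},n)$ feedback code has a message set of size $M=\lceil 2^{nR}\rceil$, measurable encoding functions $X_i(w,y^{i-1})$, $i=1,\dots,n$, and a measurable decoder $\hat W_n:\mathbb{R}^n\to\{1,\dots,M\}$. Its message $W$ is uniform on $\{1,\dots,M\}$ and independent of $(U_i)$, it is required to satisfy $\sum_{i=1}^n E\,X_i^2(W,Y^{i-1})\le nP$, and its error probability is $P_e^{(n)}=\Pr\{\hat W_n(Y^n)\ne W\}$. A real sequence $(C_n)_{n\ge1}$ is called an $n$-block feedback capacity sequence if for every $\epsilon>0$ there is a sequence of $(2^{n(C_n-\epsilon)},n)$ codes with $P_e^{(n)}\to0$, and for every $\epsilon>0$ and every sequence of $(2^{n(C_n+\epsilon)},n)$ codes there is $\delta>0$ with $P_e^{(n)}\ge\delta$ for all $n\ge1$. The feedback capacity $C_{\mathrm{FB}}$ is the limit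 of $C_n$. Theorem. The equation $$P\,x^2=(1-x^2)\,(1-|\alpha|x)^2$$ has a unique positive root $x_0$. An $n$-block feedback capacity sequence exists, every such sequence converges, and its limit is $$C_{\mathrm{FB}}=-\log_2 x_0 .$$ -/

import Mathlib

open MeasureTheory ProbabilityTheory Filter Topology
open scoped ENNReal

noncomputable section

namespace GaussianFeedback

/-- A feedback code with `M` messages and block length `n`. Times are numbered from `0`: the
symbol sent at time `i` is a function of the message and of the `i` previous channel outputs. -/
structure FeedbackCode (M n : ℕ) where
  enc : (i : Fin n) → Fin M → (Fin (i : ℕ) → ℝ) → ℝ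
  measurable_enc : ∀ i w, Measurable (enc i w)
  dec : (Fin n → ℝ) → Fin M
  measurable_dec : Measurable dec

namespace FeedbackCode

variable {M n : ℕ}

/-- The channel output at time `i`, when message `w` is sent and the noise is `z`:
`Y_i = X_i(w, Y_0, …, Y_{i-1}) + z_i`. -/
def outputAt (c : FeedbackCode M n) (w : Fin M) (z : Fin n → ℝ) (i : ℕ) (hi : i < n) : ℝ :=
  c.enc ⟨i, hi⟩ w (fun j : Fin i => c.outputAt w z j (j.2.trans hi)) + z ⟨i, hi⟩
termination_by i
decreasing_by exact j.2

/-- The block of channel outputs `Y^n`. -/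
def output (c : FeedbackCode M n) (w : Fin M) (z : Fin n → ℝ) : Fin n → ℝ :=
  fun i => c.outputAt w z i i.2

/-- The channel input `X_i`, as a function of the message and the noise. -/
def input (c : FeedbackCode M n) (w : Fin M) (z : Fin n → ℝ) (i : Fin n) : ℝ :=
  c.enc i w (fun j : Fin (i : ℕ) => c.output w z ⟨j, j.2.trans i.2⟩)

end FeedbackCode

/-- The MA(1) noise block driven by the innovations `u = (U_0, …, U_n)`. The entry of index `i` is
`α U_i + U_{i+1}`. -/
def ma1Noise (α : ℝ) {n : ℕ} (u : Fin (n + 1) → ℝ) : Fin n → ℝ :=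
  fun i => α * u i.castSucc + u i.succ

/-- The joint law of the message `W`, uniform on the `M` messages, and the innovations
`U_0, …, U_n`, i.i.d. standard Gaussian and independent of `W`. -/
def messageInnovationLaw (M n : ℕ) : Measure (Fin M × (Fin (n + 1) → ℝ)) :=
  (uniformOn (Set.univ : Set (Fin M))).prod (Measure.pi fun _ => gaussianReal 0 1)

namespace FeedbackCode

variable {M n : ℕ}

/-- The expected power constraint `∑ E X_i² ≤ n P`. -/
def SatisfiesPower (c : FeedbackCode M n) (α P : ℝ) : Prop :=
  ∑ i : Fin n, ∫⁻ p, ENNReal.ofReal (c.input p.1 (ma1Noise α p.2) i ^ 2)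
    ∂(messageInnovationLaw M n) ≤ ENNReal.ofReal (n * P)

/-- The probability of error `Pr {Ŵ(Y^n) ≠ W}`. -/
def errorProb (c : FeedbackCode M n) (α : ℝ) : ℝ :=
  (messageInnovationLaw M n).real {p | c.dec (c.output p.1 (ma1Noise α p.2)) ≠ p.1}

end FeedbackCode

/-- The number `2^{nR}` of messages at rate `R` (in bits), rounded up to an integer. -/
def numMessages (n : ℕ) (R : ℝ) : ℕ := ⌈(2 : ℝ) ^ ((n : ℝ) * R)⌉₊

/-- `C 1, C 2, …` is an `n`-block feedback capacity sequence of the MA(1) channel: for every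
`ε > 0` some codes with `2^{n(C_n-ε)}` messages have vanishing error probability, and all codes
with `2^{n(C_n+ε)}` messages have error probability bounded away from zero. -/
def IsCapacitySequence (α P : ℝ) (C : ℕ → ℝ) : Prop :=
  (∀ ε : ℝ, 0 < ε → ∃ c : (n : ℕ) → FeedbackCode (numMessages n (C n - ε)) n,
    (∀ n, 1 ≤ n → (c n).SatisfiesPower α P) ∧
      Tendsto (fun n => (c n).errorProb α) atTop (𝓝 0)) ∧
  (∀ ε : ℝ, 0 < ε → ∀ c : (n : ℕ) → FeedbackCode (numMessages n (C n + ε)) n,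
    (∀ n, 1 ≤ n → (c n).SatisfiesPower α P) →
      ∃ δ : ℝ, 0 < δ ∧ ∀ n, 1 ≤ n → δ ≤ (c n).errorProb α)

/-- `C` is the feedback capacity (in bits per transmission): `n`-block feedback capacity sequences
exist, and all of them converge to `C`. -/
def IsFeedbackCapacity (α P C : ℝ) : Prop :=
  (∃ S : ℕ → ℝ, IsCapacitySequence α P S) ∧
    ∀ S : ℕ → ℝ, IsCapacitySequence α P S → Tendsto S atTop (𝓝 C)

end GaussianFeedback

end

/-! The scale of the problem is `x₀`: the stationary power `(x⁻¹ - |α|)² (1 - x²)` decreases in `x`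
and takes the value `P` at `x₀`.

Converse. The errors of a linear one-step prediction of the channel outputs are a triangular shear
of the innovations, for each message. Compare the actual law with the one under which these
residuals are centered Gaussians of the same variances `1 + s_k`, independent of each other and of
the message: there every decoder is a blind guess, and the change of measure gives Fano's inequality
`log M ≤ ½ ∑ log (1 + s_k)` up to an error term. The recursion `s_{k+1} ≤ E_k / (1 - |α| x₀) +
(|α| / x₀) s_k / (1 + s_k)`, with `E_k` the input power, and the concavity of the logarithm at
`x₀² (1 + s) = 1` bound the sum by `-2 n log x₀` after telescoping.

Achievability. Encode the message as the initial state of an unstable linear system with growth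
factor `-ξ⁻¹`, where `|ξ|` is slightly larger than `x₀`. In closed loop the feedback turns this
factor into `-ξ`, so the state stays bounded and the outputs determine the initial state up to an
error of order `|ξ|ⁿ`. The encoder reconstructs the innovations with a parameter slightly smaller
than `|α|` in absolute value: for `|α| = 1` it would never forget its initial error. -/

noncomputable section

namespace GaussianFeedback

/-! ### Triangular shears and products of Gaussian densities -/

section Shear

variable {n : ℕ} {G : Type*} [MeasurableSpace G] [AddGroup G] [MeasurableAdd₂ G]

lemma measurePreserving_pi_add_of_dependsOn_Iio (μ : Measure G) [SigmaFinite μ]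
    [μ.IsAddRightInvariant] {g : Fin n → (Fin n → G) → G} (hg : ∀ i, Measurable (g i))
    (hdep : ∀ i, DependsOn (g i) (Set.Iio i)) :
    MeasurePreserving (fun (u : Fin n → G) i => u i + g i u)
      (Measure.pi fun _ => μ) (Measure.pi fun _ => μ) := by
  induction n with
  | zero =>
    convert MeasurePreserving.id _
  | succ n ih =>
    let e := MeasurableEquiv.piFinSuccAbove (fun _ : Fin (n + 1) => G) (Fin.last n)
    have he : MeasurePreserving e (Measure.pi fun _ => μ) (μ.prod (Measure.pi fun _ => μ)) :=
      measurePreserving_piFinSuccAbove (fun _ => μ) (Fin.last n)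
    have hsnoc : Measurable fun b : Fin n → G => e.symm (0, b) :=
      e.symm.measurable.comp measurable_prodMk_left
    have hinit : MeasurePreserving
        (fun (b : Fin n → G) i => b i + g i.castSucc (e.symm (0, b)))
        (Measure.pi fun _ => μ) (Measure.pi fun _ => μ) := by
      refine ih (g := fun i b => g i.castSucc (e.symm (0, b))) (fun i => (hg _).comp hsnoc)
        fun i b b' hb => hdep _ fun j hj => ?_
      obtain ⟨k, rfl⟩ := Fin.exists_castSucc_eq.2 (hj.trans_le (Fin.le_last _)).ne
      simpa [e] using hb k (by simpa using hj)
    have hskew : MeasurePreserving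
        (fun p : (Fin n → G) × G => ((fun i => p.1 i + g i.castSucc (e.symm (0, p.1)) : Fin n → G),
          p.2 + g (Fin.last n) (e.symm (0, p.1))))
        ((Measure.pi fun _ => μ).prod μ) ((Measure.pi fun _ => μ).prod μ) :=
      hinit.skew_product (g := fun b a => a + g (Fin.last n) (e.symm (0, b)))
        (measurable_snd.add ((hg _).comp (hsnoc.comp measurable_fst)))
        (ae_of_all _ fun b => (measurePreserving_add_right μ _).map_eq)
    convert (he.symm e).comp (Measure.measurePreserving_swap.comp
      (hskew.comp (Measure.measurePreserving_swap.comp he))) using 1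
    have hge : ∀ i u, g i u = g i (e.symm (0, (e u).2)) := fun i u => hdep i fun j hj => by
      obtain ⟨k, rfl⟩ := Fin.exists_castSucc_eq.2 (hj.trans_le (Fin.le_last _)).ne
      simp [e, Fin.init]
    funext u i
    rw [hge]
    induction i using Fin.lastCases with
    | last => simp [e]
    | cast i => simp [e, Fin.init]

end Shear

section ProductDensity

variable {n : ℕ} {X : Fin n → Type*} [∀ i, MeasurableSpace (X i)]

lemma lintegral_pi_prod_coord (μ : ∀ i, Measure (X i)) [∀ i, SigmaFinite (μ i)]
    {f : ∀ i, X i → ℝ≥0∞} (hf : ∀ i, Measurable (f i)) :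
    ∫⁻ x, ∏ i, f i (x i) ∂(Measure.pi μ) = ∏ i, ∫⁻ t, f i t ∂(μ i) := by
  induction n with
  | zero => simp
  | succ n ih =>
    have hrest : Measurable fun b : ∀ i : Fin n, X i.succ => ∏ i, f i.succ (b i) := by fun_prop
    have hsplit : MeasurePreserving (MeasurableEquiv.piFinSuccAbove X 0) (Measure.pi μ)
        ((μ 0).prod (Measure.pi fun i : Fin n => μ i.succ)) :=
      measurePreserving_piFinSuccAbove μ 0
    have hfubini := lintegral_prod_mul (μ := μ 0) (ν := Measure.pi fun i : Fin n => μ i.succ)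
      (hf 0).aemeasurable hrest.aemeasurable
    rw [← hsplit.symm.lintegral_comp_emb (MeasurableEquiv.measurableEmbedding _)]
    simp only [Fin.prod_univ_succ]
    rwa [← ih (fun i => μ i.succ) (fun i => hf i.succ)]

lemma pi_withDensity (μ : ∀ i, Measure (X i)) [∀ i, SigmaFinite (μ i)] {f : ∀ i, X i → ℝ≥0∞}
    (hf : ∀ i, Measurable (f i)) [∀ i, SigmaFinite ((μ i).withDensity (f i))] :
    Measure.pi (fun i => (μ i).withDensity (f i))
      = (Measure.pi μ).withDensity fun x => ∏ i, f i (x i) := by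
  refine Measure.pi_eq fun s hs => ?_
  have hind : (Set.univ.pi s).indicator (fun x => ∏ i, f i (x i))
      = fun x => ∏ i, (s i).indicator (f i) (x i) := by
    funext x
    by_cases hx : x ∈ Set.univ.pi s
    · rw [Set.indicator_of_mem hx]
      exact Finset.prod_congr rfl fun i _ => (Set.indicator_of_mem (hx i trivial) _).symm
    · obtain ⟨i, hi⟩ : ∃ i, x i ∉ s i := by simpa [Set.mem_pi] using hx
      rw [Set.indicator_of_notMem hx,
        Finset.prod_eq_zero (Finset.mem_univ i) (Set.indicator_of_notMem hi _)]
  rw [withDensity_apply _ (MeasurableSet.univ_pi hs), ← lintegral_indicator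
    (MeasurableSet.univ_pi hs), hind, lintegral_pi_prod_coord μ fun i => (hf i).indicator (hs i)]
  exact Finset.prod_congr rfl fun i _ => by
    rw [lintegral_indicator (hs i), withDensity_apply _ (hs i)]

end ProductDensity

section Gaussian

variable {n : ℕ}

lemma pi_gaussianReal_eq_withDensity (m : Fin n → ℝ) {v : Fin n → NNReal} (hv : ∀ i, v i ≠ 0) :
    Measure.pi (fun i => gaussianReal (m i) (v i))
      = volume.withDensity fun x : Fin n → ℝ => ∏ i, gaussianPDF (m i) (v i) (x i) := by
  have hdensity : ∀ i, volume.withDensity (gaussianPDF (m i) (v i)) = gaussianReal (m i) (v i) :=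
    fun i => (gaussianReal_of_var_ne_zero (m i) (hv i)).symm
  have hσ : ∀ i, SigmaFinite (volume.withDensity (gaussianPDF (m i) (v i))) := fun i =>
    hdensity i ▸ inferInstance
  simpa only [hdensity, volume_pi] using pi_withDensity (fun _ => (volume : Measure ℝ))
    fun i => measurable_gaussianPDF (m i) (v i)

lemma gaussianPDF_mul_exp_eq {v : NNReal} (hv : v ≠ 0) (s t : ℝ) :
    gaussianPDF 0 1 s * ENNReal.ofReal
      (Real.exp (s ^ 2 / 2 - t ^ 2 / (2 * v) - Real.log v / 2)) = gaussianPDF 0 v t := by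
  have hsqrt : Real.exp (Real.log v / 2) = √v := by
    rw [← Real.log_sqrt v.coe_nonneg, Real.exp_log (Real.sqrt_pos.2 (NNReal.coe_pos.2 hv.bot_lt))]
  have hexp : Real.exp (-(s - 0) ^ 2 / (2 * ((1 : NNReal) : ℝ)))
      * Real.exp (s ^ 2 / 2 - t ^ 2 / (2 * v) - Real.log v / 2)
        = (√v)⁻¹ * Real.exp (-(t - 0) ^ 2 / (2 * v)) := by
    rw [← hsqrt, ← Real.exp_neg, ← Real.exp_add, ← Real.exp_add]
    congr 1
    push_cast
    ring
  rw [gaussianPDF, gaussianPDF, ← ENNReal.ofReal_mul (gaussianPDFReal_nonneg _ _ _),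
    gaussianPDFReal, gaussianPDFReal, mul_assoc, hexp, NNReal.coe_one, mul_one,
    Real.sqrt_mul (by positivity : (0 : ℝ) ≤ 2 * Real.pi) (v : ℝ), mul_inv, mul_assoc]

lemma lintegral_comp_mul_likelihoodRatio {v : Fin n → NNReal} (hv : ∀ i, v i ≠ 0)
    {T : (Fin n → ℝ) → Fin n → ℝ} (hT : MeasurePreserving T) {F : (Fin n → ℝ) → ℝ≥0∞}
    (hF : Measurable F) :
    ∫⁻ u, F (T u) * ENNReal.ofReal (Real.exp
        (∑ i, (u i ^ 2 / 2 - T u i ^ 2 / (2 * v i) - Real.log (v i) / 2)))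
        ∂(Measure.pi fun _ => gaussianReal 0 1)
      = ∫⁻ x, F x ∂(Measure.pi fun i => gaussianReal 0 (v i)) := by
  have hdensity : ∀ w : Fin n → NNReal,
      Measurable fun x : Fin n → ℝ => ∏ i, gaussianPDF 0 (w i) (x i) :=
    by fun_prop
  have hFT : Measurable fun u => F (T u) := hF.comp hT.measurable
  have hratio : Measurable fun u : Fin n → ℝ => ENNReal.ofReal (Real.exp
      (∑ i, (u i ^ 2 / 2 - T u i ^ 2 / (2 * v i) - Real.log (v i) / 2))) := by
    have := hT.measurable
    fun_prop
  rw [pi_gaussianReal_eq_withDensity (fun _ => 0) (v := fun _ => 1) (fun _ => one_ne_zero),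
    pi_gaussianReal_eq_withDensity _ hv]
  refine (lintegral_withDensity_eq_lintegral_mul _ (hdensity _) (hFT.mul hratio)).trans ?_
  rw [lintegral_withDensity_eq_lintegral_mul _ (hdensity _) hF,
    ← hT.lintegral_comp ((hdensity _).mul hF)]
  refine lintegral_congr fun u => ?_
  simp only [Pi.mul_apply]
  rw [Real.exp_sum, ENNReal.ofReal_prod_of_nonneg fun i _ => (Real.exp_pos _).le,
    mul_left_comm, ← Finset.prod_mul_distrib, mul_comm]
  simp only [gaussianPDF_mul_exp_eq (hv _)]

end Gaussian

/-! ### Change of measure and guessing -/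

section Fano

variable {Ω : Type*} [MeasurableSpace Ω] {μ : Measure Ω}

lemma integral_eq_zero_of_comp_eq_neg {T : Ω → Ω} (hT : MeasurePreserving T μ μ)
    (hemb : MeasurableEmbedding T) {f : Ω → ℝ} (hf : ∀ ω, f (T ω) = -f ω) :
    ∫ ω, f ω ∂μ = 0 := by
  have h := hT.integral_comp hemb f
  simp only [hf, integral_neg] at h
  linarith

lemma setIntegral_add_log_le [IsFiniteMeasure μ] {l : Ω → ℝ} (hl : Integrable l μ) (A : Set Ω)
    {c b : ℝ} (hc : 0 < c) (hb : 0 ≤ b)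
    (hexp : ∫⁻ ω in A, ENNReal.ofReal (Real.exp (l ω)) ∂μ ≤ ENNReal.ofReal b) :
    ∫ ω in A, l ω ∂μ + μ.real A * (Real.log c + 1) ≤ c * b := by
  have hint : IntegrableOn (fun ω => Real.exp (l ω)) A μ :=
    ⟨(Real.continuous_exp.comp_aestronglyMeasurable hl.1).restrict,
      (hasFiniteIntegral_iff_ofReal (ae_of_all _ fun ω => (Real.exp_pos _).le)).2
        (hexp.trans_lt ENNReal.ofReal_lt_top)⟩
  have hmass : ∫ ω in A, Real.exp (l ω) ∂μ ≤ b := by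
    rw [integral_eq_lintegral_of_nonneg_ae (ae_of_all _ fun ω => (Real.exp_pos _).le) hint.1]
    exact ENNReal.toReal_le_of_le_ofReal hb hexp
  calc ∫ ω in A, l ω ∂μ + μ.real A * (Real.log c + 1)
      = ∫ ω in A, (l ω + (Real.log c + 1)) ∂μ := by
        rw [integral_add hl.integrableOn (integrable_const _), setIntegral_const, smul_eq_mul]
    _ ≤ ∫ ω in A, c * Real.exp (l ω) ∂μ := by
        refine integral_mono (hl.integrableOn.add (integrable_const _)) (hint.const_mul c)
          fun ω => ?_
        have h := Real.add_one_le_exp (l ω + Real.log c)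
        rw [Real.exp_add, Real.exp_log hc] at h
        linarith
    _ = c * ∫ ω in A, Real.exp (l ω) ∂μ := integral_const_mul c _
    _ ≤ c * b := by gcongr

-- With `q` the probability of a correct guess this is Fano's inequality; keeping `q` free avoids
-- the binary entropy function.
lemma measureReal_mul_log_add_integral_le [IsProbabilityMeasure μ] {l : Ω → ℝ}
    (hl : Integrable l μ) {A : Set Ω} (hA : MeasurableSet A) {M q : ℝ} (hM : 0 < M) (hq : 0 < q)
    (hq1 : q < 1) (htotal : ∫⁻ ω, ENNReal.ofReal (Real.exp (l ω)) ∂μ ≤ 1)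
    (hmass : ∫⁻ ω in A, ENNReal.ofReal (Real.exp (l ω)) ∂μ ≤ ENNReal.ofReal M⁻¹) :
    μ.real A * Real.log M + ∫ ω, l ω ∂μ
      ≤ -(μ.real A * Real.log q) - μ.real Aᶜ * Real.log (1 - q) := by
  have hin := setIntegral_add_log_le hl A (mul_pos hq hM) (inv_nonneg.2 hM.le) hmass
  have hout := setIntegral_add_log_le hl Aᶜ (sub_pos.2 hq1) zero_le_one
    ((setLIntegral_le_lintegral _ _).trans (htotal.trans_eq ENNReal.ofReal_one.symm))
  have hsum := integral_add_compl hA hl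
  rw [mul_inv_cancel_right₀ hM.ne', Real.log_mul hq.ne' hM.ne'] at hin
  linarith [probReal_add_probReal_compl (μ := μ) hA]

lemma uniformOn_prod_apply_guess {ι : Type*} [Fintype ι] [MeasurableSpace ι]
    [MeasurableSingletonClass ι] (ν : Measure Ω) [IsProbabilityMeasure ν] {φ : Ω → ι}
    (hφ : Measurable φ) :
    (uniformOn (Set.univ : Set ι)).prod ν {p | φ p.2 = p.1} = (Fintype.card ι : ℝ≥0∞)⁻¹ := by
  have hmeas : MeasurableSet {p : ι × Ω | φ p.2 = p.1} :=
    measurableSet_eq_fun (hφ.comp measurable_snd) measurable_fst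
  have hsection : ∀ ω, (fun i => (i, ω)) ⁻¹' {p : ι × Ω | φ p.2 = p.1} = {φ ω} := fun ω => by
    ext i
    simp [eq_comm]
  simp [Measure.prod_apply_symm hmeas, hsection, uniformOn_univ]

end Fano

/-! ### Adapted random variables -/

/-- A sample point: the message together with the block of innovations `U_0, …, U_n`. -/
abbrev Sample (M n : ℕ) : Type := Fin M × (Fin (n + 1) → ℝ)

/-- The extension of a finite block by zero to a sequence, which lets time range over `ℕ`. -/
def extendZero {m : ℕ} (y : Fin m → ℝ) (j : ℕ) : ℝ := if h : j < m then y ⟨j, h⟩ else 0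

/-- The innovation `U_k`, as a random variable on the sample space; it is `0` for `n < k`. -/
def innovation {M n : ℕ} (k : ℕ) : Sample M n → ℝ := fun p => extendZero p.2 k

/-- The mean square `E f²` of a random variable. -/
def meanSq {M n : ℕ} (f : Sample M n → ℝ) : ℝ := ∫ p, f p ^ 2 ∂(messageInnovationLaw M n)

/-- The square integrable random variables that are functions of the message and of the
innovations `U_0, …, U_{k-1}`. Measurability is required everywhere, not only almost everywhere,
because these functions also enter as shears of the sample space. -/
def adaptedL2 {M n : ℕ} (k : ℕ) : Submodule ℝ (Sample M n → ℝ) where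
  carrier := {f | Measurable f ∧ MemLp f 2 (messageInnovationLaw M n) ∧
    ∀ w, DependsOn (fun u => f (w, u)) {j | (j : ℕ) < k}}
  zero_mem' := ⟨measurable_const, MemLp.zero', fun _ _ _ _ => rfl⟩
  add_mem' hf hg := ⟨hf.1.add hg.1, hf.2.1.add hg.2.1, fun w _ _ h =>
    congrArg₂ (· + ·) (hf.2.2 w h) (hg.2.2 w h)⟩
  smul_mem' r _ hf := ⟨hf.1.const_smul r, hf.2.1.const_smul r, fun w _ _ h =>
    congrArg (r • ·) (hf.2.2 w h)⟩

lemma mem_adaptedL2 {M n k : ℕ} {f : Sample M n → ℝ} : f ∈ adaptedL2 k ↔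
    Measurable f ∧ MemLp f 2 (messageInnovationLaw M n) ∧
      ∀ w, DependsOn (fun u => f (w, u)) {j | (j : ℕ) < k} := Iff.rfl

lemma memLp_of_mem_adaptedL2 {M n k : ℕ} {f : Sample M n → ℝ} (hf : f ∈ adaptedL2 k) :
    MemLp f 2 (messageInnovationLaw M n) := hf.2.1

lemma extendZero_of_lt {m j : ℕ} (y : Fin m → ℝ) (h : j < m) : extendZero y j = y ⟨j, h⟩ :=
  dif_pos h

lemma extendZero_of_le {m j : ℕ} (y : Fin m → ℝ) (h : m ≤ j) : extendZero y j = 0 :=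
  dif_neg h.not_gt

lemma measurable_extendZero {m : ℕ} (j : ℕ) : Measurable fun y : Fin m → ℝ => extendZero y j := by
  unfold extendZero
  split_ifs <;> fun_prop

lemma innovation_val {M n : ℕ} (p : Sample M n) (i : Fin (n + 1)) : innovation i p = p.2 i :=
  extendZero_of_lt p.2 i.2

/-- The reflection of one coordinate of `ℝᵐ`. -/
def reflectAt {m : ℕ} (j : Fin m) : (Fin m → ℝ) ≃ᵐ (Fin m → ℝ) :=
  MeasurableEquiv.piCongrRight fun i =>
    if i = j then MeasurableEquiv.neg ℝ else MeasurableEquiv.refl ℝ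

lemma reflectAt_apply_self {m : ℕ} (j : Fin m) (u : Fin m → ℝ) : reflectAt j u j = -u j := by
  simp [reflectAt, MeasurableEquiv.piCongrRight, Equiv.piCongrRight]

lemma reflectAt_apply_of_ne {m : ℕ} {i j : Fin m} (h : i ≠ j) (u : Fin m → ℝ) :
    reflectAt j u i = u i := by
  simp [reflectAt, MeasurableEquiv.piCongrRight, Equiv.piCongrRight, h]

lemma measurePreserving_reflectAt {m : ℕ} (j : Fin m) (v : Fin m → NNReal) :
    MeasurePreserving (reflectAt j) (Measure.pi fun i => gaussianReal 0 (v i))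
      (Measure.pi fun i => gaussianReal 0 (v i)) := by
  refine measurePreserving_pi _ _ fun i => ?_
  by_cases h : i = j
  · simp only [h, if_true]
    exact ⟨measurable_neg, by simpa using gaussianReal_map_neg (μ := 0) (v := v j)⟩
  · simp only [h, if_false]
    exact MeasurePreserving.id _

section Law

variable {M n : ℕ}

lemma adaptedL2_mono : Monotone (adaptedL2 : ℕ → Submodule ℝ (Sample M n → ℝ)) :=
  fun _ _ hkl _ hf => mem_adaptedL2.2 ⟨hf.1, hf.2.1, fun w =>
    (hf.2.2 w).mono fun _ hj => hj.trans_le hkl⟩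

lemma meanSq_nonneg (f : Sample M n → ℝ) : 0 ≤ meanSq f := integral_nonneg fun _ => sq_nonneg _

lemma meanSq_smul (r : ℝ) (f : Sample M n → ℝ) : meanSq (r • f) = r ^ 2 * meanSq f := by
  simp only [meanSq, Pi.smul_apply, smul_eq_mul, mul_pow, integral_const_mul]

lemma meanSq_add_le {f g : Sample M n → ℝ} (hf : MemLp f 2 (messageInnovationLaw M n))
    (hg : MemLp g 2 (messageInnovationLaw M n)) {t : ℝ} (ht : 0 < t) (ht1 : t < 1) :
    meanSq (f + g) ≤ meanSq f / (1 - t) + meanSq g / t := by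
  have ht1' : 0 < 1 - t := sub_pos.2 ht1
  have hpoint : ∀ a b : ℝ, (a + b) ^ 2 ≤ a ^ 2 / (1 - t) + b ^ 2 / t := by
    intro a b
    have h : a ^ 2 / (1 - t) + b ^ 2 / t - (a + b) ^ 2
        = (t * a - (1 - t) * b) ^ 2 / (t * (1 - t)) := by
      field_simp
      ring
    linarith [show 0 ≤ (t * a - (1 - t) * b) ^ 2 / (t * (1 - t)) by positivity]
  simp only [meanSq, ← integral_div]
  rw [← integral_add (hf.integrable_sq.div_const _) (hg.integrable_sq.div_const _)]
  exact integral_mono (hf.add hg).integrable_sq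
    ((hf.integrable_sq.div_const _).add (hg.integrable_sq.div_const _)) fun p => hpoint _ _

lemma message_mem_adaptedL2 (f : Fin M → ℝ) :
    (fun p : Sample M n => f p.1) ∈ adaptedL2 0 := by
  refine mem_adaptedL2.2 ⟨(measurable_of_finite f).comp measurable_fst, ?_, fun _ _ _ _ => rfl⟩
  exact MemLp.of_discrete.comp_measurePreserving (ν := uniformOn Set.univ) measurePreserving_fst

lemma integral_mul_innovation_eq_zero {k : ℕ} (hk : k ≤ n) {f : Sample M n → ℝ}
    (hf : f ∈ adaptedL2 k) : ∫ p, f p * innovation k p ∂(messageInnovationLaw M n) = 0 := by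
  let j : Fin (n + 1) := ⟨k, Nat.lt_succ_of_le hk⟩
  have hreflect : MeasurePreserving (Prod.map id (reflectAt j)) (messageInnovationLaw M n)
      (messageInnovationLaw M n) :=
    (MeasurePreserving.id _).prod (measurePreserving_reflectAt j fun _ => 1)
  refine integral_eq_zero_of_comp_eq_neg hreflect
    ((MeasurableEquiv.refl (Fin M)).prodCongr (reflectAt j)).measurableEmbedding fun p => ?_
  have hfix : f (p.1, reflectAt j p.2) = f p :=
    (mem_adaptedL2.1 hf).2.2 p.1 fun i hi => reflectAt_apply_of_ne (Fin.ne_of_lt hi) p.2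
  rw [show k = j from rfl, innovation_val, innovation_val]
  change f (p.1, reflectAt j p.2) * reflectAt j p.2 j = _
  rw [hfix, reflectAt_apply_self, mul_neg]

variable [NeZero M]

instance : IsProbabilityMeasure (messageInnovationLaw M n) := by
  unfold messageInnovationLaw
  infer_instance

lemma measurePreserving_eval_innovation (j : Fin (n + 1)) :
    MeasurePreserving (fun p : Sample M n => p.2 j) (messageInnovationLaw M n)
      (gaussianReal 0 1) :=
  (measurePreserving_eval (fun _ : Fin (n + 1) => gaussianReal 0 1) j).comp
    measurePreserving_snd

lemma innovation_mem_adaptedL2 {j k : ℕ} (hjk : j < k) :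
    (innovation j : Sample M n → ℝ) ∈ adaptedL2 k := by
  by_cases hj : j < n + 1
  · have heval : (innovation j : Sample M n → ℝ) = fun p => p.2 ⟨j, hj⟩ :=
      funext fun p => extendZero_of_lt p.2 hj
    rw [heval]
    exact mem_adaptedL2.2 ⟨by fun_prop, (memLp_id_gaussianReal 2).comp_measurePreserving
      (measurePreserving_eval_innovation ⟨j, hj⟩), fun _ _ _ h => h ⟨j, hj⟩ hjk⟩
  · have hzero : (innovation j : Sample M n → ℝ) = 0 :=
      funext fun p => extendZero_of_le p.2 (not_lt.1 hj)
    exact hzero ▸ zero_mem _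

lemma meanSq_innovation {k : ℕ} (hk : k ≤ n) : meanSq (innovation k : Sample M n → ℝ) = 1 := by
  have hgauss : ∫ t, t ^ 2 ∂(gaussianReal 0 1) = 1 := by
    simpa [variance_eq_integral aemeasurable_id', integral_id_gaussianReal] using
      variance_fun_id_gaussianReal (μ := 0) (v := 1)
  have heval := measurePreserving_eval_innovation (M := M) (⟨k, Nat.lt_succ_of_le hk⟩ : Fin (n + 1))
  rw [← hgauss, ← heval.map_eq, integral_map heval.aemeasurable (by fun_prop), meanSq]
  simp only [innovation, extendZero_of_lt _ (Nat.lt_succ_of_le hk)]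

lemma meanSq_add_innovation {k : ℕ} (hk : k ≤ n) {f : Sample M n → ℝ} (hfk : f ∈ adaptedL2 k)
    (r s : ℝ) : meanSq (r • f + s • innovation k) = r ^ 2 * meanSq f + s ^ 2 := by
  have hf := memLp_of_mem_adaptedL2 hfk
  have hU := memLp_of_mem_adaptedL2 (innovation_mem_adaptedL2 (M := M) (n := n) k.lt_succ_self)
  have hexpand : ∀ p : Sample M n, (r • f + s • innovation k : Sample M n → ℝ) p ^ 2
      = r ^ 2 * f p ^ 2 + s ^ 2 * innovation k p ^ 2 + 2 * r * s * (f p * innovation k p) := by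
    intro p
    simp only [Pi.add_apply, Pi.smul_apply, smul_eq_mul]
    ring
  have hcross : Integrable (fun p => 2 * r * s * (f p * innovation k p))
      (messageInnovationLaw M n) := (hf.integrable_mul hU).const_mul _
  have hsquares : Integrable (fun p => r ^ 2 * f p ^ 2 + s ^ 2 * innovation k p ^ 2)
      (messageInnovationLaw M n) :=
    (hf.integrable_sq.const_mul _).add (hU.integrable_sq.const_mul _)
  rw [meanSq, integral_congr_ae (ae_of_all _ hexpand), integral_add hsquares hcross,
    integral_add (hf.integrable_sq.const_mul _) (hU.integrable_sq.const_mul _),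
    integral_const_mul, integral_const_mul, integral_const_mul,
    integral_mul_innovation_eq_zero hk hfk]
  change r ^ 2 * meanSq f + s ^ 2 * meanSq (innovation k) + _ = _
  rw [meanSq_innovation hk]
  ring

end Law

lemma measurable_ma1Noise (α : ℝ) {n : ℕ} : Measurable (ma1Noise α (n := n)) := by
  unfold ma1Noise
  fun_prop

namespace FeedbackCode

variable {M n : ℕ}

lemma neZero (c : FeedbackCode M n) : NeZero M := ⟨(c.dec 0).pos.ne'⟩

variable (c : FeedbackCode M n)

lemma outputAt_eq_enc_add (w : Fin M) (z : Fin n → ℝ) (i : ℕ) (hi : i < n) :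
    c.outputAt w z i hi
      = c.enc ⟨i, hi⟩ w (fun j : Fin i => c.outputAt w z j (j.2.trans hi)) + z ⟨i, hi⟩ := by
  rw [outputAt]

lemma output_eq_input_add (w : Fin M) (z : Fin n → ℝ) (i : Fin n) :
    c.output w z i = c.input w z i + z i :=
  c.outputAt_eq_enc_add w z i i.2

lemma dependsOn_outputAt (w : Fin M) (i : ℕ) (hi : i < n) :
    DependsOn (fun z => c.outputAt w z i hi) {j | (j : ℕ) ≤ i} := by
  induction i using Nat.strong_induction_on with
  | _ i ih =>
    intro z z' h
    simp only [c.outputAt_eq_enc_add w _ i hi]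
    rw [h ⟨i, hi⟩ (le_refl i)]
    congr 2
    funext j
    exact (ih j j.2 _).mono (fun k hk => hk.trans j.2.le) h

lemma dependsOn_input (w : Fin M) (i : Fin n) :
    DependsOn (fun z => c.input w z i) (Set.Iio i) := fun _ _ h =>
  congrArg (c.enc i w) <| funext fun j =>
    c.dependsOn_outputAt w j _ fun _ hk => h _ (Fin.lt_def.2 (hk.trans_lt j.2))

lemma measurable_outputAt (w : Fin M) (i : ℕ) (hi : i < n) :
    Measurable fun z => c.outputAt w z i hi := by
  induction i using Nat.strong_induction_on with
  | _ i ih =>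
    simp only [c.outputAt_eq_enc_add w _ i hi]
    exact ((c.measurable_enc ⟨i, hi⟩ w).comp (measurable_pi_iff.2 fun j => ih j j.2 _)).add
      (measurable_pi_apply _)

lemma measurable_output (w : Fin M) : Measurable (c.output w) :=
  measurable_pi_iff.2 fun i => c.measurable_outputAt w i i.2

lemma measurable_input (w : Fin M) : Measurable (c.input w) :=
  measurable_pi_iff.2 fun i =>
    (c.measurable_enc i w).comp (measurable_pi_iff.2 fun j => c.measurable_outputAt w j _)

lemma measurable_dec_output (α : ℝ) :
    Measurable fun p : Sample M n => c.dec (c.output p.1 (ma1Noise α p.2)) :=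
  measurable_from_prod_countable_right fun w =>
    c.measurable_dec.comp ((c.measurable_output w).comp (measurable_ma1Noise α))

/-- The channel input at time `k` as a random variable; it is `0` from time `n` on. -/
def inputAt (α : ℝ) (k : ℕ) : Sample M n → ℝ :=
  fun p => extendZero (c.input p.1 (ma1Noise α p.2)) k

lemma measurable_inputAt (α : ℝ) (k : ℕ) : Measurable (c.inputAt α k) :=
  measurable_from_prod_countable_right fun w =>
    (measurable_extendZero k).comp ((c.measurable_input w).comp (measurable_ma1Noise α))

lemma dependsOn_inputAt (α : ℝ) (k : ℕ) (w : Fin M) :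
    DependsOn (fun u => c.inputAt α k (w, u)) {j | (j : ℕ) < k + 1} := by
  intro u u' h
  by_cases hk : k < n
  · simp only [inputAt, extendZero_of_lt _ hk]
    refine c.dependsOn_input w ⟨k, hk⟩ fun j hj => ?_
    have hjk : (j : ℕ) < k := hj
    rw [ma1Noise, ma1Noise, h j.castSucc (hjk.trans k.lt_succ_self),
      h j.succ (Nat.succ_lt_succ hjk)]
  · simp only [inputAt, extendZero_of_le _ (not_lt.1 hk)]

lemma inputAt_val (α : ℝ) (i : Fin n) (p : Sample M n) :
    c.inputAt α i p = c.input p.1 (ma1Noise α p.2) i := extendZero_of_lt _ i.2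

lemma output_eq_inputAt_add (α : ℝ) (p : Sample M n) (i : Fin n) :
    c.output p.1 (ma1Noise α p.2) i
      = c.inputAt α i p + α * innovation i p + innovation (i + 1) p := by
  have hU : innovation i p = p.2 i.castSucc := innovation_val p i.castSucc
  have hU' : innovation (i + 1) p = p.2 i.succ := innovation_val p i.succ
  rw [output_eq_input_add, inputAt_val, hU, hU', ma1Noise, add_assoc]

lemma inputAt_of_le (α : ℝ) {k : ℕ} (hk : n ≤ k) : c.inputAt α k = 0 :=
  funext fun _ => extendZero_of_le _ hk

variable {c} {α P : ℝ}

lemma SatisfiesPower.memLp_inputAt (hc : c.SatisfiesPower α P) (k : ℕ) :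
    MemLp (c.inputAt α k) 2 (messageInnovationLaw M n) := by
  by_cases hk : k < n
  · rw [memLp_two_iff_integrable_sq (c.measurable_inputAt α k).aestronglyMeasurable]
    refine ⟨((c.measurable_inputAt α k).pow_const 2).aestronglyMeasurable, ?_⟩
    rw [hasFiniteIntegral_iff_ofReal (ae_of_all _ fun p => sq_nonneg _)]
    simp only [inputAt, extendZero_of_lt _ hk]
    exact (Finset.single_le_sum (f := fun i => ∫⁻ p, ENNReal.ofReal
      (c.input p.1 (ma1Noise α p.2) i ^ 2) ∂(messageInnovationLaw M n)) (fun _ _ => zero_le)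
        (Finset.mem_univ (⟨k, hk⟩ : Fin n))).trans_lt (hc.trans_lt ENNReal.ofReal_lt_top)
  · exact c.inputAt_of_le α (not_lt.1 hk) ▸ MemLp.zero'

lemma SatisfiesPower.inputAt_mem_adaptedL2 (hc : c.SatisfiesPower α P) (k : ℕ) :
    c.inputAt α k ∈ adaptedL2 (k + 1) :=
  mem_adaptedL2.2 ⟨c.measurable_inputAt α k, hc.memLp_inputAt k, c.dependsOn_inputAt α k⟩

lemma satisfiesPower_iff (hP : 0 ≤ P)
    (hL : ∀ k, MemLp (c.inputAt α k) 2 (messageInnovationLaw M n)) :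
    c.SatisfiesPower α P ↔ ∑ k ∈ Finset.range n, meanSq (c.inputAt α k) ≤ n * P := by
  have hterm : ∀ i : Fin n, ∫⁻ p, ENNReal.ofReal (c.input p.1 (ma1Noise α p.2) i ^ 2)
      ∂(messageInnovationLaw M n) = ENNReal.ofReal (meanSq (c.inputAt α i)) := fun i => by
    rw [meanSq, ofReal_integral_eq_lintegral_ofReal (hL i).integrable_sq
      (ae_of_all _ fun p => sq_nonneg _)]
    simp only [inputAt_val]
  simp only [SatisfiesPower, hterm]
  rw [← ENNReal.ofReal_sum_of_nonneg fun i _ => meanSq_nonneg _,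
    ENNReal.ofReal_le_ofReal_iff (by positivity),
    Fin.sum_univ_eq_sum_range fun k => meanSq (c.inputAt α k)]

end FeedbackCode

/-! ### The stationary power -/

/-- The stationary power of the linear feedback scheme in which the uncertainty about the message
contracts by the factor `x` in each step. For `x ≠ 0` it equals `P` exactly when
`P x² = (1 - x²) (1 - β x)²`. -/
def stationaryPower (β x : ℝ) : ℝ := (x⁻¹ - β) ^ 2 * (1 - x ^ 2)

section StationaryPower

variable {β x P : ℝ}

lemma stationaryPower_eq_iff (hx : x ≠ 0) :
    stationaryPower β x = P ↔ P * x ^ 2 = (1 - x ^ 2) * (1 - β * x) ^ 2 := by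
  have h : stationaryPower β x * x ^ 2 = (1 - x ^ 2) * (1 - β * x) ^ 2 := by
    rw [stationaryPower]
    field_simp
  rw [← h, mul_left_inj' (pow_ne_zero 2 hx), eq_comm]

lemma stationaryPower_neg_neg : stationaryPower (-β) (-x) = stationaryPower β x := by
  rw [stationaryPower, stationaryPower, inv_neg]
  ring

lemma lt_one_of_stationaryPower_pos (h : 0 < stationaryPower β x) : x < 1 := by
  have hpos : 0 < 1 - x ^ 2 := pos_of_mul_pos_right h (sq_nonneg _)
  nlinarith

lemma stationaryPower_strictAntiOn (hβ : β ≤ 1) :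
    StrictAntiOn (stationaryPower β) (Set.Ioo 0 1) := by
  intro x hx y hy hxy
  have hinv : y⁻¹ < x⁻¹ := inv_strictAnti₀ hx.1 hxy
  have hgap : 0 < y⁻¹ - β := by linarith [(one_lt_inv₀ hy.1).2 hy.2]
  have hpow : x ^ 2 < y ^ 2 := pow_lt_pow_left₀ hxy hx.1.le two_ne_zero
  have hy2 : y ^ 2 < 1 := pow_lt_one₀ hy.1.le hy.2 two_ne_zero
  exact mul_lt_mul'' (pow_lt_pow_left₀ (by linarith) hgap.le two_ne_zero) (by linarith)
    (sq_nonneg _) (by linarith)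

lemma exists_stationaryPower_eq (β : ℝ) (hP : 0 < P) :
    ∃ x ∈ Set.Ioo (0 : ℝ) 1, stationaryPower β x = P := by
  have hcont : Continuous fun x : ℝ => (1 - x ^ 2) * (1 - β * x) ^ 2 - P * x ^ 2 := by fun_prop
  obtain ⟨x, hx, hroot⟩ := intermediate_value_Ioo' zero_le_one hcont.continuousOn
    (show (0 : ℝ) ∈ Set.Ioo _ _ by constructor <;> norm_num [hP])
  exact ⟨x, hx, (stationaryPower_eq_iff hx.1.ne').2 (by linarith)⟩

/-- Concavity of the logarithm at the stationary point `x² (1 + v) = 1`. -/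
lemma stationaryPower_add_log_le {v : ℝ} (hβ : 0 ≤ β) (hx : 0 < x) (hβx : β * x ≤ 1)
    (hv : 0 ≤ v) :
    stationaryPower β x
        + (1 - β * x) * (1 / x ^ 2 - β * x) * (Real.log (1 + v) + 2 * Real.log x)
      ≤ (1 - β * x) * (v - β / x * (v / (1 + v))) := by
  obtain ⟨F, hF⟩ : ∃ F, F = x ^ 2 * (1 + v) := ⟨_, rfl⟩
  have hFpos : 0 < F := hF ▸ by positivity
  have hlog : Real.log (1 + v) + 2 * Real.log x = Real.log F := by
    rw [hF, Real.log_mul (by positivity) (by positivity), Real.log_pow]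
    push_cast
    ring
  have hupper : Real.log F / x ^ 2 ≤ (F - 1) / x ^ 2 := by
    gcongr
    exact Real.log_le_sub_one_of_pos hFpos
  have hlower : β * x * (1 - F⁻¹) ≤ β * x * Real.log F := by
    gcongr
    exact Real.one_sub_inv_le_log_of_pos hFpos
  have hgap : (1 - β * x) * (v - β / x * (v / (1 + v))) - stationaryPower β x
      = (1 - β * x) * ((F - 1) / x ^ 2 - β * x * (1 - F⁻¹)) := by
    rw [stationaryPower, hF]
    field_simp
    ring
  have hconcave : (1 - β * x) * ((1 / x ^ 2 - β * x) * Real.log F)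
      ≤ (1 - β * x) * ((F - 1) / x ^ 2 - β * x * (1 - F⁻¹)) := by
    refine mul_le_mul_of_nonneg_left ?_ (by linarith)
    rw [sub_mul, one_div_mul_eq_div]
    linarith
  rw [hlog]
  linarith

lemma sum_log_one_add_le {n : ℕ} {s E : ℕ → ℝ} (hβ : 0 ≤ β) (hx : 0 < x) (hx1 : x < 1)
    (hβx : β * x < 1) (hs0 : s 0 = 0) (hs : ∀ k, 0 ≤ s k)
    (hstep : ∀ k < n, s (k + 1) ≤ E k / (1 - β * x) + β / x * (s k / (1 + s k)))
    (hE : ∑ k ∈ Finset.range n, E k ≤ n * stationaryPower β x) :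
    ∑ k ∈ Finset.range (n + 1), Real.log (1 + s k) ≤ 2 * n * -Real.log x := by
  have hβx' : 0 < 1 - β * x := sub_pos.2 hβx
  have hcoef : 0 < (1 - β * x) * (1 / x ^ 2 - β * x) := by
    refine mul_pos hβx' (sub_pos.2 (hβx.trans ?_))
    exact (one_lt_div (by positivity)).2 (pow_lt_one₀ hx.le hx1 two_ne_zero)
  obtain ⟨g, hg⟩ : ∃ g : ℕ → ℝ, g = fun k => (1 - β * x) * (β / x) * (s k / (1 + s k)) := ⟨_, rfl⟩
  have hterm : ∀ k ∈ Finset.range n, stationaryPower β x + (1 - β * x) * (1 / x ^ 2 - β * x)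
      * (Real.log (1 + s (k + 1)) + 2 * Real.log x) ≤ E k + (g k - g (k + 1)) := by
    intro k hk
    have htangent := stationaryPower_add_log_le hβ hx hβx.le (hs (k + 1))
    have hscaled := mul_le_mul_of_nonneg_left (hstep k (Finset.mem_range.1 hk)) hβx'.le
    rw [mul_add, mul_div_cancel₀ _ hβx'.ne'] at hscaled
    simp only [hg]
    linarith
  have hsum := Finset.sum_le_sum hterm
  have hgn : 0 ≤ g n := by
    have := hs n
    simp only [hg]
    positivity
  simp only [Finset.sum_add_distrib, ← Finset.mul_sum, Finset.sum_range_sub', Finset.sum_const,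
    Finset.card_range, nsmul_eq_mul] at hsum
  have hg0 : g 0 = 0 := by simp [hg, hs0]
  have hle : ∑ k ∈ Finset.range n, Real.log (1 + s (k + 1)) + n * (2 * Real.log x) ≤ 0 :=
    nonpos_of_mul_nonpos_right (by linarith) hcoef
  rw [Finset.sum_range_succ', hs0, add_zero, Real.log_one, add_zero]
  linarith

end StationaryPower

/-! ### Linear prediction of the channel outputs -/

section Prediction

variable {M n : ℕ} (α : ℝ) (X : ℕ → Sample M n → ℝ)

/-- For inputs `X`, the part of the channel output `X_{k-1} + α U_{k-1} + U_k` that remains after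
`U_k` and the linear prediction of `U_{k-1}` from the past outputs have been removed. The
prediction starts from the knowledge of `U_0`. -/
def unpredicted : ℕ → Sample M n → ℝ
  | 0 => 0
  | k + 1 => X k + α • (innovation k
      - (1 + meanSq (unpredicted k))⁻¹ • (unpredicted k + innovation k))

/-- The error of the channel output as predicted linearly from the past; it starts with `U_0`. -/
def residual (k : ℕ) : Sample M n → ℝ := unpredicted α X k + innovation k

/-- The coefficient of the residual of index `k` in the linear prediction of `U_k`. -/
def predictorGain (k : ℕ) : ℝ := (1 + meanSq (unpredicted α X k))⁻¹

/-- The error of the linear prediction of `U_k`. -/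
def predictionError (k : ℕ) : Sample M n → ℝ :=
  innovation k - predictorGain α X k • residual α X k

lemma unpredicted_succ (k : ℕ) :
    unpredicted α X (k + 1) = X k + α • predictionError α X k := rfl

lemma residual_succ_add_smul_residual (k : ℕ) :
    residual α X (k + 1) + α • predictorGain α X k • residual α X k
      = X k + α • innovation k + innovation (k + 1) := by
  rw [residual, unpredicted_succ, predictionError, smul_sub]
  abel

/-- The variance of the residual of index `k`. -/
def residualVar (k : ℕ) : NNReal := 1 + ⟨meanSq (unpredicted α X k), meanSq_nonneg _⟩

lemma coe_residualVar (k : ℕ) : (residualVar α X k : ℝ) = 1 + meanSq (unpredicted α X k) := rfl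

variable {α X} [NeZero M]

lemma unpredicted_mem_adaptedL2 (hX : ∀ k, X k ∈ adaptedL2 (k + 1)) (k : ℕ) :
    unpredicted α X k ∈ adaptedL2 k := by
  induction k with
  | zero => exact zero_mem _
  | succ k ih =>
    have hU : (innovation k : Sample M n → ℝ) ∈ adaptedL2 (k + 1) :=
      innovation_mem_adaptedL2 k.lt_succ_self
    exact add_mem (hX k) (Submodule.smul_mem _ _ (sub_mem hU
      (Submodule.smul_mem _ _ (add_mem (adaptedL2_mono k.le_succ ih) hU))))

lemma residual_mem_adaptedL2 (hX : ∀ k, X k ∈ adaptedL2 (k + 1)) (k : ℕ) :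
    residual α X k ∈ adaptedL2 (k + 1) :=
  add_mem (adaptedL2_mono k.le_succ (unpredicted_mem_adaptedL2 hX k))
    (innovation_mem_adaptedL2 k.lt_succ_self)

lemma predictionError_mem_adaptedL2 (hX : ∀ k, X k ∈ adaptedL2 (k + 1)) (k : ℕ) :
    predictionError α X k ∈ adaptedL2 (k + 1) :=
  sub_mem (innovation_mem_adaptedL2 k.lt_succ_self)
    (Submodule.smul_mem _ _ (residual_mem_adaptedL2 hX k))

lemma meanSq_residual (hX : ∀ k, X k ∈ adaptedL2 (k + 1)) {k : ℕ} (hk : k ≤ n) :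
    meanSq (residual α X k) = residualVar α X k := by
  have h := meanSq_add_innovation hk (unpredicted_mem_adaptedL2 (α := α) hX k) 1 1
  rw [one_smul, one_smul] at h
  rw [residual, h, coe_residualVar]
  ring

lemma meanSq_predictionError (hX : ∀ k, X k ∈ adaptedL2 (k + 1)) {k : ℕ} (hk : k ≤ n) :
    meanSq (predictionError α X k)
      = meanSq (unpredicted α X k) / (1 + meanSq (unpredicted α X k)) := by
  have hs := meanSq_nonneg (unpredicted α X k)
  have hsplit : predictionError α X k = -predictorGain α X k • unpredicted α X k
      + (1 - predictorGain α X k) • innovation k := by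
    rw [predictionError, residual]
    module
  rw [hsplit, meanSq_add_innovation hk (unpredicted_mem_adaptedL2 hX k), predictorGain]
  field_simp
  ring

lemma meanSq_unpredicted_succ_le (hX : ∀ k, X k ∈ adaptedL2 (k + 1)) {k : ℕ} (hk : k ≤ n)
    {x : ℝ} (hx : 0 < x) (hαx : |α| * x < 1) :
    meanSq (unpredicted α X (k + 1)) ≤ meanSq (X k) / (1 - |α| * x)
      + |α| / x * (meanSq (unpredicted α X k) / (1 + meanSq (unpredicted α X k))) := by
  rw [unpredicted_succ, ← meanSq_predictionError hX hk]
  rcases eq_or_ne α 0 with rfl | hα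
  · simp
  · refine (meanSq_add_le (memLp_of_mem_adaptedL2 (hX k)) (memLp_of_mem_adaptedL2
      (Submodule.smul_mem _ _ (predictionError_mem_adaptedL2 hX k)))
      (mul_pos (abs_pos.2 hα) hx) hαx).trans_eq ?_
    rw [meanSq_smul, ← sq_abs α]
    field_simp [abs_ne_zero.2 hα]

end Prediction

section ChangeOfMeasure

variable {M n : ℕ} (α : ℝ) (X : ℕ → Sample M n → ℝ)

/-- The block of residuals, as a transformation of the innovations for each message. -/
def residuals (p : Sample M n) : Fin (n + 1) → ℝ := fun i => residual α X i p

/-- The logarithm of the density of a centered Gaussian variable with the variance of the residual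
of index `i`, at that residual, relative to the standard Gaussian density at `U_i`. -/
def logRatioTerm (i : Fin (n + 1)) (p : Sample M n) : ℝ :=
  p.2 i ^ 2 / 2 - residuals α X p i ^ 2 / (2 * residualVar α X i)
    - Real.log (residualVar α X i) / 2

/-- The logarithm of the likelihood ratio between independent centered Gaussian variables with the
variances of the residuals, evaluated at the residuals, and the actual law. -/
def logRatio (p : Sample M n) : ℝ := ∑ i, logRatioTerm α X i p

/-- The law of the message and the residuals if the residuals were independent of each other and
of the message. -/
def independentLaw : Measure (Sample M n) :=
  (uniformOn (Set.univ : Set (Fin M))).prod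
    (Measure.pi fun i => gaussianReal 0 (residualVar α X i))

lemma residualVar_pos (k : ℕ) : 0 < residualVar α X k :=
  add_pos_of_pos_of_nonneg one_pos zero_le

variable {α X} [NeZero M]

lemma measurable_residuals (hX : ∀ k, X k ∈ adaptedL2 (k + 1)) : Measurable (residuals α X) :=
  measurable_pi_iff.2 fun i => (mem_adaptedL2.1 (residual_mem_adaptedL2 hX i)).1

lemma measurePreserving_residuals (hX : ∀ k, X k ∈ adaptedL2 (k + 1)) (w : Fin M) :
    MeasurePreserving fun u => residuals α X (w, u) := by
  have hmem := fun i : Fin (n + 1) => mem_adaptedL2.1 (unpredicted_mem_adaptedL2 (α := α) hX i)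
  convert measurePreserving_pi_add_of_dependsOn_Iio volume
    (g := fun (i : Fin (n + 1)) u => unpredicted α X i (w, u))
    (fun i => (hmem i).1.comp measurable_prodMk_left) fun i => (hmem i).2.2 w using 1
  · funext u i
    rw [residuals, residual, Pi.add_apply, innovation_val, add_comm]
  all_goals rfl

lemma measurable_logRatio (hX : ∀ k, X k ∈ adaptedL2 (k + 1)) : Measurable (logRatio α X) := by
  have := measurable_residuals (α := α) hX
  unfold logRatio logRatioTerm
  fun_prop

lemma lintegral_comp_residuals_mul_exp_logRatio (hX : ∀ k, X k ∈ adaptedL2 (k + 1))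
    {F : Sample M n → ℝ≥0∞} (hF : Measurable F) :
    ∫⁻ p, F (p.1, residuals α X p) * ENNReal.ofReal (Real.exp (logRatio α X p))
        ∂(messageInnovationLaw M n)
      = ∫⁻ p, F p ∂(independentLaw α X) := by
  have hres := measurable_residuals (α := α) hX
  have hlog := measurable_logRatio (α := α) hX
  rw [messageInnovationLaw, independentLaw, lintegral_prod _ (by fun_prop),
    lintegral_prod _ hF.aemeasurable]
  exact lintegral_congr fun w => lintegral_comp_mul_likelihoodRatio
    (fun i => (residualVar_pos α X i).ne') (measurePreserving_residuals hX w)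
    (F := fun u => F (w, u)) (by fun_prop)

lemma lintegral_exp_logRatio (hX : ∀ k, X k ∈ adaptedL2 (k + 1)) :
    ∫⁻ p, ENNReal.ofReal (Real.exp (logRatio α X p)) ∂(messageInnovationLaw M n) = 1 := by
  have h := lintegral_comp_residuals_mul_exp_logRatio (α := α) hX (F := 1) measurable_one
  simpa [independentLaw] using h

lemma setLIntegral_exp_logRatio (hX : ∀ k, X k ∈ adaptedL2 (k + 1)) {φ : (Fin (n + 1) → ℝ) → Fin M}
    (hφ : Measurable φ) :
    ∫⁻ p in {p | φ (residuals α X p) = p.1}, ENNReal.ofReal (Real.exp (logRatio α X p))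
      ∂(messageInnovationLaw M n) = (M : ℝ≥0∞)⁻¹ := by
  have hguess : MeasurableSet {q : Sample M n | φ q.2 = q.1} :=
    measurableSet_eq_fun (hφ.comp measurable_snd) measurable_fst
  have hcorrect : MeasurableSet {p : Sample M n | φ (residuals α X p) = p.1} :=
    measurableSet_eq_fun (hφ.comp (measurable_residuals hX)) measurable_fst
  have h := lintegral_comp_residuals_mul_exp_logRatio (α := α) hX
    (F := {q | φ q.2 = q.1}.indicator 1) (measurable_one.indicator hguess)
  rw [lintegral_indicator_one hguess, independentLaw, uniformOn_prod_apply_guess _ hφ,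
    Fintype.card_fin] at h
  rw [← h, ← lintegral_indicator hcorrect]
  refine lintegral_congr fun p => ?_
  simp only [Set.indicator_apply, Set.mem_ofPred_eq, Pi.one_apply, ite_mul, one_mul, zero_mul]

lemma integrable_innovation_sq_div (i : Fin (n + 1)) :
    Integrable (fun p : Sample M n => p.2 i ^ 2 / 2) (messageInnovationLaw M n) := by
  simp only [← innovation_val]
  exact (memLp_of_mem_adaptedL2
    (innovation_mem_adaptedL2 (i : ℕ).lt_succ_self)).integrable_sq.div_const 2

lemma integrable_residuals_sq_div (hX : ∀ k, X k ∈ adaptedL2 (k + 1)) (i : Fin (n + 1)) :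
    Integrable (fun p => residuals α X p i ^ 2 / (2 * residualVar α X i))
      (messageInnovationLaw M n) :=
  (memLp_of_mem_adaptedL2 (residual_mem_adaptedL2 hX i)).integrable_sq.div_const _

lemma integrable_logRatioTerm (hX : ∀ k, X k ∈ adaptedL2 (k + 1)) (i : Fin (n + 1)) :
    Integrable (logRatioTerm α X i) (messageInnovationLaw M n) :=
  ((integrable_innovation_sq_div i).sub (integrable_residuals_sq_div hX i)).sub
    (integrable_const _)

lemma integral_logRatioTerm (hX : ∀ k, X k ∈ adaptedL2 (k + 1)) (i : Fin (n + 1)) :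
    ∫ p, logRatioTerm α X i p ∂(messageInnovationLaw M n)
      = -(Real.log (residualVar α X i) / 2) := by
  have hi : (i : ℕ) ≤ n := Nat.lt_succ_iff.1 i.2
  have hv : (residualVar α X i : ℝ) ≠ 0 := by exact_mod_cast (residualVar_pos α X i).ne'
  have hinnovation : ∫ p : Sample M n, p.2 i ^ 2 ∂(messageInnovationLaw M n) = 1 := by
    simp only [← innovation_val]
    exact meanSq_innovation hi
  have hresidual : ∫ p, residuals α X p i ^ 2 ∂(messageInnovationLaw M n) = residualVar α X i :=
    meanSq_residual hX hi
  have hsplit : logRatioTerm α X i = (fun p => p.2 i ^ 2 / 2)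
      - (fun p => residuals α X p i ^ 2 / (2 * residualVar α X i))
      - fun _ => Real.log (residualVar α X i) / 2 := rfl
  rw [hsplit, integral_sub' ((integrable_innovation_sq_div i).sub
    (integrable_residuals_sq_div hX i)) (integrable_const _), integral_sub'
    (integrable_innovation_sq_div i) (integrable_residuals_sq_div hX i), integral_div,
    integral_div, hinnovation, hresidual, integral_const, probReal_univ, one_smul]
  field_simp
  ring

lemma integrable_logRatio (hX : ∀ k, X k ∈ adaptedL2 (k + 1)) :
    Integrable (logRatio α X) (messageInnovationLaw M n) :=
  integrable_finsetSum _ fun i _ => integrable_logRatioTerm hX i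

lemma integral_logRatio (hX : ∀ k, X k ∈ adaptedL2 (k + 1)) :
    ∫ p, logRatio α X p ∂(messageInnovationLaw M n)
      = -(∑ k ∈ Finset.range (n + 1), Real.log (1 + meanSq (unpredicted α X k))) / 2 := by
  unfold logRatio
  rw [integral_finsetSum _ fun i _ => integrable_logRatioTerm hX i,
    Finset.sum_congr rfl fun i _ => integral_logRatioTerm hX i,
    Fin.sum_univ_eq_sum_range fun k => -(Real.log (residualVar α X k) / 2),
    Finset.sum_neg_distrib, ← Finset.sum_div, neg_div]
  simp only [coe_residualVar]

end ChangeOfMeasure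

section Converse

variable {M n : ℕ} {α x : ℝ} {X : ℕ → Sample M n → ℝ}

lemma neg_integral_logRatio_le [NeZero M] (hX : ∀ k, X k ∈ adaptedL2 (k + 1)) (hx : 0 < x)
    (hx1 : x < 1) (hαx : |α| * x < 1)
    (hpower : ∑ k ∈ Finset.range n, meanSq (X k) ≤ n * stationaryPower |α| x) :
    -∫ p, logRatio α X p ∂(messageInnovationLaw M n) ≤ n * -Real.log x := by
  have hsum := sum_log_one_add_le (s := fun k => meanSq (unpredicted α X k)) (abs_nonneg α) hx hx1
    hαx (by simp [unpredicted, meanSq]) (fun k => meanSq_nonneg _)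
    (fun k hk => meanSq_unpredicted_succ_le hX hk.le hx hαx) hpower
  rw [integral_logRatio hX]
  linarith

variable (α X) in
/-- The channel outputs as a function of the residuals. -/
def outputOfResiduals (e : Fin (n + 1) → ℝ) : Fin n → ℝ :=
  fun i => e i.succ + α * (predictorGain α X i * e i.castSucc)

lemma measurable_outputOfResiduals : Measurable (outputOfResiduals α X) := by
  unfold outputOfResiduals
  fun_prop

namespace FeedbackCode

lemma outputOfResiduals_residuals (c : FeedbackCode M n) (p : Sample M n) :
    outputOfResiduals α (c.inputAt α) (residuals α (c.inputAt α) p)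
      = c.output p.1 (ma1Noise α p.2) := by
  funext i
  have h := congrFun (residual_succ_add_smul_residual α (c.inputAt α) i) p
  simp only [Pi.add_apply, Pi.smul_apply, smul_eq_mul] at h
  rw [output_eq_inputAt_add, ← h]
  rfl

lemma measurableSet_correct (c : FeedbackCode M n) (α : ℝ) :
    MeasurableSet {p : Sample M n | c.dec (c.output p.1 (ma1Noise α p.2)) = p.1} :=
  measurableSet_eq_fun (c.measurable_dec_output α) measurable_fst

lemma measureReal_correct [NeZero M] (c : FeedbackCode M n) (α : ℝ) :
    (messageInnovationLaw M n).real {p | c.dec (c.output p.1 (ma1Noise α p.2)) = p.1}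
      = 1 - c.errorProb α :=
  eq_sub_of_add_eq (probReal_add_probReal_compl (c.measurableSet_correct α))

lemma setLIntegral_correct_exp_logRatio [NeZero M] (c : FeedbackCode M n)
    (hX : ∀ k, c.inputAt α k ∈ adaptedL2 (k + 1)) :
    ∫⁻ p in {p | c.dec (c.output p.1 (ma1Noise α p.2)) = p.1},
      ENNReal.ofReal (Real.exp (logRatio α (c.inputAt α) p)) ∂(messageInnovationLaw M n)
      = (M : ℝ≥0∞)⁻¹ := by
  simpa only [Function.comp_apply, c.outputOfResiduals_residuals] using
    setLIntegral_exp_logRatio (α := α) hX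
      (c.measurable_dec.comp (measurable_outputOfResiduals (α := α) (X := c.inputAt α)))

variable {c : FeedbackCode M n}

lemma SatisfiesPower.one_sub_errorProb_mul_log_le (hx : 0 < x) (hx1 : x < 1) (hαx : |α| * x < 1)
    (hc : c.SatisfiesPower α (stationaryPower |α| x)) {q : ℝ} (hq : 0 < q) (hq1 : q < 1) :
    (1 - c.errorProb α) * Real.log M ≤ n * -Real.log x
      - (1 - c.errorProb α) * Real.log q - c.errorProb α * Real.log (1 - q) := by
  have := c.neZero
  have hM : (0 : ℝ) < M := Nat.cast_pos.2 (NeZero.pos M)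
  have hX := hc.inputAt_mem_adaptedL2
  have hP : 0 ≤ stationaryPower |α| x :=
    mul_nonneg (sq_nonneg _) (sub_nonneg.2 (pow_le_one₀ hx.le hx1.le))
  have hbound := measureReal_mul_log_add_integral_le (integrable_logRatio hX)
    (c.measurableSet_correct α) hM hq hq1 (lintegral_exp_logRatio hX).le
    ((c.setLIntegral_correct_exp_logRatio hX).trans_le
      (by rw [ENNReal.ofReal_inv_of_pos hM, ENNReal.ofReal_natCast]))
  rw [probReal_compl_eq_one_sub (c.measurableSet_correct α), c.measureReal_correct] at hbound
  have hinfo := neg_integral_logRatio_le hX hx hx1 hαx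
    ((satisfiesPower_iff hP hc.memLp_inputAt).1 hc)
  linarith

lemma SatisfiesPower.div_le_errorProb (hx : 0 < x) (hx1 : x < 1) (hαx : |α| * x < 1)
    (hc : c.SatisfiesPower α (stationaryPower |α| x)) (hn : 1 ≤ n) {E : ℝ} (hE : 0 < E)
    (hM : n * (-Real.log x + E) ≤ Real.log M) :
    E / 2 / (-Real.log x + E - Real.log (1 - Real.exp (-(E / 2)))) ≤ c.errorProb α := by
  have := c.neZero
  have hn' : (1 : ℝ) ≤ n := Nat.one_le_cast.2 hn
  have hL : 0 < -Real.log x := neg_pos.2 (Real.log_neg hx hx1)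
  have hq1 : Real.exp (-(E / 2)) < 1 := Real.exp_lt_one_iff.2 (by linarith)
  have hpenalty : 0 ≤ -Real.log (1 - Real.exp (-(E / 2))) := neg_nonneg.2
    (Real.log_nonpos (by linarith) (by linarith [Real.exp_pos (-(E / 2))]))
  have he : 0 ≤ c.errorProb α := measureReal_nonneg
  have he1 : 0 ≤ 1 - c.errorProb α := c.measureReal_correct α ▸ measureReal_nonneg
  have hfano := hc.one_sub_errorProb_mul_log_le hx hx1 hαx (Real.exp_pos (-(E / 2))) hq1
  rw [Real.log_exp] at hfano
  have hrate := mul_le_mul_of_nonneg_left hM he1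
  have hEn : E / 2 ≤ n * (E / 2) := le_mul_of_one_le_left (by linarith) hn'
  have heE : 0 ≤ c.errorProb α * (E / 2) := by positivity
  have hpen : c.errorProb α * -Real.log (1 - Real.exp (-(E / 2)))
      ≤ n * (c.errorProb α * -Real.log (1 - Real.exp (-(E / 2)))) :=
    le_mul_of_one_le_left (mul_nonneg he hpenalty) hn'
  rw [div_le_iff₀ (by linarith)]
  refine le_of_mul_le_mul_left (a := (n : ℝ)) ?_ (by linarith)
  linarith

end FeedbackCode

end Converse

/-! ### Linear feedback codes -/

/-- The autoregressive filter `e_k = y_k - r e_{k-1}`. -/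
def arFilter (r : ℝ) (y : ℕ → ℝ) : ℕ → ℝ
  | 0 => y 0
  | k + 1 => y (k + 1) - r * arFilter r y k

/-- The state of the linear system `d_{k+1} = l d_k + b e_k` started from `θ`, where `e` is the
sequence `y` filtered by `arFilter r`. -/
def linearState (l b r θ : ℝ) (y : ℕ → ℝ) : ℕ → ℝ
  | 0 => θ
  | k + 1 => l * linearState l b r θ y k + b * arFilter r y k

section LinearCode

variable {l b r θ : ℝ}

lemma measurable_arFilter {m : ℕ} (r : ℝ) (k : ℕ) :
    Measurable fun y : Fin m → ℝ => arFilter r (extendZero y) k := by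
  induction k with
  | zero => exact measurable_extendZero 0
  | succ k ih => exact (measurable_extendZero (k + 1)).sub (ih.const_mul r)

lemma measurable_linearState {m : ℕ} (l b r θ : ℝ) (k : ℕ) :
    Measurable fun y : Fin m → ℝ => linearState l b r θ (extendZero y) k := by
  induction k with
  | zero => exact measurable_const
  | succ k ih => exact (ih.const_mul l).add ((measurable_arFilter r k).const_mul b)

lemma dependsOn_arFilter (r : ℝ) (k : ℕ) : DependsOn (arFilter r · k) (Set.Iic k) := by
  induction k with
  | zero => exact fun _ _ h => h 0 (Set.mem_Iic.2 le_rfl)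
  | succ k ih =>
    exact fun y y' h => congrArg₂ (· - r * ·) (h (k + 1) (Set.mem_Iic.2 le_rfl))
      (ih fun j hj => h j (Set.Iic_subset_Iic.2 k.le_succ hj))

lemma dependsOn_linearState (l b r θ : ℝ) (k : ℕ) :
    DependsOn (linearState l b r θ · k) (Set.Iio k) := by
  induction k with
  | zero => exact fun _ _ _ => rfl
  | succ k ih =>
    exact fun y y' h => congrArg₂ (l * · + b * ·)
      (ih fun j hj => h j (Set.Iio_subset_Iio k.le_succ hj))
      (dependsOn_arFilter r k fun j hj => h j (Nat.lt_succ_of_le hj))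

lemma linearState_eq_pow_mul_add (y : ℕ → ℝ) (k : ℕ) :
    linearState l b r θ y k = l ^ k * θ + linearState l b r 0 y k := by
  induction k with
  | zero => simp [linearState]
  | succ k ih =>
    rw [linearState, ih, linearState]
    ring

variable {M : ℕ} [NeZero M]

/-- The message `w` whose point `w / M` is closest to `t`, provided that `t` is close enough to one
of these points. -/
def nearestMessage (M : ℕ) [NeZero M] (t : ℝ) : Fin M := Fin.ofNat M ⌊M * t + 1 / 2⌋₊

lemma measurable_nearestMessage : Measurable (nearestMessage M) :=
  (measurable_from_top (f := Fin.ofNat M)).comp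
    (Nat.measurable_floor.comp ((measurable_id.const_mul _).add_const _))

lemma nearestMessage_eq_of_abs_sub_lt {t : ℝ} {w : Fin M} (h : |M * t - (w : ℕ)| < 1 / 2) :
    nearestMessage M t = w := by
  rw [abs_lt] at h
  have hfloor : ⌊M * t + 1 / 2⌋₊ = (w : ℕ) :=
    (Nat.floor_eq_iff (by linarith [Nat.cast_nonneg (α := ℝ) (w : ℕ)])).2
      ⟨by linarith, by linarith⟩
  rw [nearestMessage, hfloor, Fin.ofNat_val_eq_self]

variable (M) in
/-- The feedback code that sends `g` times the state of a linear system, which is driven by the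
channel outputs and started from the message point `w / M`. -/
def linearCode (n : ℕ) (g l b r : ℝ) : FeedbackCode M n where
  enc i w y := g * linearState l b r ((w : ℕ) / M) (extendZero y) i
  measurable_enc i _ := (measurable_linearState l b r _ i).const_mul g
  dec y := nearestMessage M (-(linearState l b r 0 (extendZero y) n) / l ^ n)
  measurable_dec := measurable_nearestMessage.comp
    ((measurable_linearState l b r 0 n).neg.div_const _)

lemma input_linearCode {n : ℕ} (g l b r : ℝ) (w : Fin M) (z : Fin n → ℝ) (i : Fin n) :
    (linearCode M n g l b r).input w z i
      = g * linearState l b r ((w : ℕ) / M)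
        (extendZero ((linearCode M n g l b r).output w z)) i := by
  refine congrArg (g * ·) (dependsOn_linearState l b r _ i fun j hj => ?_)
  rw [extendZero_of_lt _ hj, extendZero_of_lt _ (lt_trans hj i.2)]

lemma half_le_of_dec_linearCode_ne {n : ℕ} {g : ℝ} (hl : l ≠ 0) {w : Fin M} {y : Fin n → ℝ}
    (h : (linearCode M n g l b r).dec y ≠ w) :
    1 / 2 ≤ M * |l⁻¹| ^ n * |linearState l b r ((w : ℕ) / M) (extendZero y) n| := by
  contrapose! h
  refine nearestMessage_eq_of_abs_sub_lt ?_
  have hM : (M : ℝ) ≠ 0 := Nat.cast_ne_zero.2 (NeZero.ne M)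
  have hln : l ^ n ≠ 0 := pow_ne_zero n hl
  have hdiff : M * (-(linearState l b r 0 (extendZero y) n) / l ^ n) - (w : ℕ)
      = -(M * l⁻¹ ^ n * linearState l b r ((w : ℕ) / M) (extendZero y) n) := by
    rw [linearState_eq_pow_mul_add (θ := (w : ℕ) / M), inv_pow]
    field_simp
    ring
  rwa [hdiff, abs_neg, abs_mul, abs_mul, abs_pow, Nat.abs_cast]

end LinearCode

lemma sum_add_le_of_add_succ_le {A V : ℕ → ℝ} {κ : ℝ} (n : ℕ)
    (h : ∀ k < n, A k + V (k + 1) ≤ V k + κ) :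
    ∑ k ∈ Finset.range n, A k + V n ≤ V 0 + n * κ := by
  induction n with
  | zero => simp
  | succ n ih =>
    rw [Finset.sum_range_succ, Nat.cast_succ]
    linarith [ih fun k hk => h k (Nat.lt_succ_of_lt hk), h n n.lt_succ_self]

/-- The message point `W / M` of the unit interval. -/
def messagePoint {M n : ℕ} : Sample M n → ℝ := fun p => (p.1 : ℕ) / M

/-- The error with which the encoder of `loopCode` reconstructs the innovation `U_{k+1}`. -/
def loopBias {M n : ℕ} (α a : ℝ) : ℕ → Sample M n → ℝ
  | 0 => -a • messagePoint + α • innovation 0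
  | k + 1 => -a • loopBias α a k + (α - a) • innovation (k + 1)

/-- The state of `loopCode` in closed loop, as a random variable. -/
def loopState {M n : ℕ} (α a ξ : ℝ) : ℕ → Sample M n → ℝ
  | 0 => messagePoint
  | k + 1 => (-ξ • loopState α a ξ k + (1 - ξ ^ 2) • loopBias α a k)
      + (1 - ξ ^ 2) • innovation (k + 1)

/-- The linear code whose state, an unstable system of growth factor `-ξ⁻¹` when uncontrolled,
contracts by the reciprocal factor `-ξ` in closed loop. The parameter `a` is the encoder's estimate
of `α`. -/
def loopCode (M n : ℕ) [NeZero M] (a ξ : ℝ) : FeedbackCode M n :=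
  linearCode M n (ξ⁻¹ - a) (-ξ⁻¹) (1 - ξ ^ 2) (a * ξ ^ 2)

section ClosedLoop

variable {M n : ℕ}

lemma messagePoint_mem_adaptedL2 : (messagePoint : Sample M n → ℝ) ∈ adaptedL2 0 :=
  message_mem_adaptedL2 fun w => (w : ℕ) / M

variable [NeZero M]

lemma meanSq_messagePoint_le_one : meanSq (messagePoint : Sample M n → ℝ) ≤ 1 := by
  refine (integral_mono (memLp_of_mem_adaptedL2 messagePoint_mem_adaptedL2).integrable_sq
    (integrable_const 1) fun p => ?_).trans_eq (by simp)
  exact pow_le_one₀ (by unfold messagePoint; positivity)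
    (div_le_one_of_le₀ (Nat.cast_le.2 p.1.2.le) M.cast_nonneg)

lemma loopBias_mem_adaptedL2 (α a : ℝ) (k : ℕ) :
    (loopBias α a k : Sample M n → ℝ) ∈ adaptedL2 (k + 1) := by
  induction k with
  | zero =>
    exact add_mem (Submodule.smul_mem _ _ (adaptedL2_mono zero_le_one messagePoint_mem_adaptedL2))
      (Submodule.smul_mem _ _ (innovation_mem_adaptedL2 zero_lt_one))
  | succ k ih =>
    exact add_mem (Submodule.smul_mem _ _ (adaptedL2_mono (k + 1).le_succ ih))
      (Submodule.smul_mem _ _ (innovation_mem_adaptedL2 (k + 1).lt_succ_self))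

lemma loopState_mem_adaptedL2 (α a ξ : ℝ) (k : ℕ) :
    (loopState α a ξ k : Sample M n → ℝ) ∈ adaptedL2 (k + 1) := by
  induction k with
  | zero => exact adaptedL2_mono zero_le_one messagePoint_mem_adaptedL2
  | succ k ih =>
    exact add_mem (adaptedL2_mono (k + 1).le_succ (add_mem (Submodule.smul_mem _ _ ih)
      (Submodule.smul_mem _ _ (loopBias_mem_adaptedL2 α a k))))
      (Submodule.smul_mem _ _ (innovation_mem_adaptedL2 (k + 1).lt_succ_self))

lemma memLp_loopBias (α a : ℝ) (k : ℕ) :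
    MemLp (loopBias α a k : Sample M n → ℝ) 2 (messageInnovationLaw M n) :=
  memLp_of_mem_adaptedL2 (loopBias_mem_adaptedL2 α a k)

lemma memLp_loopState (α a ξ : ℝ) (k : ℕ) :
    MemLp (loopState α a ξ k : Sample M n → ℝ) 2 (messageInnovationLaw M n) :=
  memLp_of_mem_adaptedL2 (loopState_mem_adaptedL2 α a ξ k)

lemma meanSq_loopBias_zero_le {α a : ℝ} (hα : α ^ 2 ≤ 1) (ha : a ^ 2 ≤ 1) :
    meanSq (loopBias α a 0 : Sample M n → ℝ) ≤ 2 := by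
  rw [loopBias, meanSq_add_innovation (Nat.zero_le n) messagePoint_mem_adaptedL2, neg_sq]
  linarith [mul_le_one₀ ha (meanSq_nonneg _) (meanSq_messagePoint_le_one (M := M) (n := n))]

lemma meanSq_loopBias_succ (α a : ℝ) {k : ℕ} (hk : k < n) :
    meanSq (loopBias α a (k + 1) : Sample M n → ℝ)
      = a ^ 2 * meanSq (loopBias α a k : Sample M n → ℝ) + (α - a) ^ 2 := by
  rw [loopBias, meanSq_add_innovation hk (loopBias_mem_adaptedL2 α a k), neg_sq]

lemma meanSq_loopState_succ_le (α a ξ : ℝ) {t : ℝ} (ht : 0 < t) (ht1 : t < 1) {k : ℕ}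
    (hk : k < n) :
    meanSq (loopState α a ξ (k + 1) : Sample M n → ℝ)
      ≤ ξ ^ 2 / (1 - t) * meanSq (loopState α a ξ k : Sample M n → ℝ)
        + (1 - ξ ^ 2) ^ 2 / t * meanSq (loopBias α a k : Sample M n → ℝ) + (1 - ξ ^ 2) ^ 2 := by
  have hadd := meanSq_add_le ((memLp_loopState (M := M) (n := n) α a ξ k).const_smul (-ξ))
    ((memLp_loopBias α a k).const_smul (1 - ξ ^ 2)) ht ht1
  rw [meanSq_smul, meanSq_smul, neg_sq] at hadd
  have hmem := add_mem
    (Submodule.smul_mem _ (-ξ) (loopState_mem_adaptedL2 (M := M) (n := n) α a ξ k))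
    (Submodule.smul_mem _ (1 - ξ ^ 2) (loopBias_mem_adaptedL2 α a k))
  have hinnov := meanSq_add_innovation hk hmem 1 (1 - ξ ^ 2)
  rw [one_smul, one_pow, one_mul] at hinnov
  rw [loopState, hinnov, div_mul_eq_mul_div, div_mul_eq_mul_div]
  gcongr

variable {α a ξ t : ℝ}

lemma sum_meanSq_loopState_le (hα : α ^ 2 ≤ 1) (ha : a ^ 2 < 1) (ht : 0 < t) (ht1 : t < 1)
    (hbias : (α - a) ^ 2 ≤ t ^ 2 * (1 - a ^ 2)) :
    (1 - ξ ^ 2 / (1 - t)) * ∑ k ∈ Finset.range n, meanSq (loopState α a ξ k : Sample M n → ℝ)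
        + meanSq (loopState α a ξ n : Sample M n → ℝ)
      ≤ 1 + 2 * ((1 - ξ ^ 2) ^ 2 / (t * (1 - a ^ 2))) + n * ((1 - ξ ^ 2) ^ 2 * (1 + t)) := by
  have ha' : 0 < 1 - a ^ 2 := sub_pos.2 ha
  set D : ℕ → ℝ := fun k => meanSq (loopState α a ξ k : Sample M n → ℝ)
  set B : ℕ → ℝ := fun k => meanSq (loopBias α a k : Sample M n → ℝ)
  set lam := (1 - ξ ^ 2) ^ 2 / (t * (1 - a ^ 2)) with hlam
  have hlam0 : 0 ≤ lam := by positivity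
  have hlam_mul : lam * (1 - a ^ 2) = (1 - ξ ^ 2) ^ 2 / t := by
    rw [hlam]
    field_simp
  have hdrive : lam * (α - a) ^ 2 ≤ (1 - ξ ^ 2) ^ 2 * t :=
    calc lam * (α - a) ^ 2 ≤ lam * (t ^ 2 * (1 - a ^ 2)) := by gcongr
      _ = (1 - ξ ^ 2) ^ 2 * t := by
        rw [hlam]
        field_simp
  -- `D + lam * B` is a Lyapunov function of the closed loop.
  have htele := sum_add_le_of_add_succ_le (A := fun k => (1 - ξ ^ 2 / (1 - t)) * D k)
    (V := fun k => D k + lam * B k) (κ := (1 - ξ ^ 2) ^ 2 * (1 + t)) n fun k hk => by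
      have hD : D (k + 1) ≤ _ := meanSq_loopState_succ_le α a ξ ht ht1 hk
      have hB : B (k + 1) = _ := meanSq_loopBias_succ α a hk
      rw [← hlam_mul] at hD
      simp only [hB]
      linarith
  rw [← Finset.mul_sum] at htele
  have hD0 : D 0 ≤ 1 := meanSq_messagePoint_le_one
  have hB0 : lam * B 0 ≤ lam * 2 := by
    gcongr
    exact meanSq_loopBias_zero_le hα ha.le
  have hBn : 0 ≤ lam * B n := mul_nonneg hlam0 (meanSq_nonneg _)
  linarith

lemma inputAt_loopCode_eq_mul_linearState (p : Sample M n) {k : ℕ} (hk : k < n) :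
    (loopCode M n a ξ).inputAt α k p = (ξ⁻¹ - a) *
      linearState (-ξ⁻¹) (1 - ξ ^ 2) (a * ξ ^ 2) (messagePoint p)
        (extendZero ((loopCode M n a ξ).output p.1 (ma1Noise α p.2))) k :=
  ((loopCode M n a ξ).inputAt_val α ⟨k, hk⟩ p).trans (input_linearCode _ _ _ _ _ _ _)

lemma linearState_and_arFilter_loopCode (hξ : ξ ≠ 0) (p : Sample M n) {k : ℕ} (hk : k < n) :
    let y := extendZero ((loopCode M n a ξ).output p.1 (ma1Noise α p.2))
    linearState (-ξ⁻¹) (1 - ξ ^ 2) (a * ξ ^ 2) (messagePoint p) y k = loopState α a ξ k p ∧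
      arFilter (a * ξ ^ 2) y k
        = ξ⁻¹ * loopState α a ξ k p + innovation (k + 1) p + loopBias α a k p := by
  intro y
  have hy : ∀ j < n, y j
      = (ξ⁻¹ - a) * linearState (-ξ⁻¹) (1 - ξ ^ 2) (a * ξ ^ 2) (messagePoint p) y j
        + α * innovation j p + innovation (j + 1) p := fun j hj => by
    rw [← inputAt_loopCode_eq_mul_linearState (α := α) p hj]
    exact (extendZero_of_lt _ hj).trans
      ((loopCode M n a ξ).output_eq_inputAt_add α p ⟨j, hj⟩)
  induction k with
  | zero =>
    refine ⟨rfl, ?_⟩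
    rw [arFilter, hy 0 hk]
    simp only [linearState, loopState, loopBias, Pi.add_apply, Pi.smul_apply, smul_eq_mul]
    ring
  | succ k ih =>
    obtain ⟨hstate, hfilter⟩ := ih (Nat.lt_of_succ_lt hk)
    have hstate' : linearState (-ξ⁻¹) (1 - ξ ^ 2) (a * ξ ^ 2) (messagePoint p) y (k + 1)
        = loopState α a ξ (k + 1) p := by
      simp only [linearState, loopState, Pi.add_apply, Pi.smul_apply, smul_eq_mul, hstate, hfilter]
      field_simp
      ring
    refine ⟨hstate', ?_⟩
    rw [arFilter, hy (k + 1) hk, hstate', hfilter]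
    simp only [loopState, loopBias, Pi.add_apply, Pi.smul_apply, smul_eq_mul]
    field_simp
    ring

lemma linearState_loopCode (hξ : ξ ≠ 0) (p : Sample M n) :
    linearState (-ξ⁻¹) (1 - ξ ^ 2) (a * ξ ^ 2) (messagePoint p)
      (extendZero ((loopCode M n a ξ).output p.1 (ma1Noise α p.2))) n = loopState α a ξ n p := by
  cases n with
  | zero => rfl
  | succ k =>
    obtain ⟨hstate, hfilter⟩ :=
      linearState_and_arFilter_loopCode (α := α) (a := a) hξ p k.lt_succ_self
    simp only [linearState, hstate, hfilter, loopState, Pi.add_apply, Pi.smul_apply, smul_eq_mul]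
    field_simp
    ring

lemma inputAt_loopCode (hξ : ξ ≠ 0) {k : ℕ} (hk : k < n) :
    (loopCode M n a ξ).inputAt α k = (ξ⁻¹ - a) • loopState α a ξ k := funext fun p => by
  rw [inputAt_loopCode_eq_mul_linearState p hk, (linearState_and_arFilter_loopCode hξ p hk).1]
  rfl

lemma memLp_inputAt_loopCode (hξ : ξ ≠ 0) (k : ℕ) :
    MemLp ((loopCode M n a ξ).inputAt α k) 2 (messageInnovationLaw M n) := by
  by_cases hk : k < n
  · rw [inputAt_loopCode hξ hk]
    exact (memLp_loopState α a ξ k).const_smul _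
  · exact (loopCode M n a ξ).inputAt_of_le α (not_lt.1 hk) ▸ MemLp.zero'

lemma loopCode_satisfiesPower_iff (hξ : ξ ≠ 0) {P : ℝ} (hP : 0 ≤ P) :
    (loopCode M n a ξ).SatisfiesPower α P ↔
      (ξ⁻¹ - a) ^ 2 * ∑ k ∈ Finset.range n, meanSq (loopState α a ξ k : Sample M n → ℝ)
        ≤ n * P := by
  rw [FeedbackCode.satisfiesPower_iff hP (memLp_inputAt_loopCode hξ), Finset.mul_sum,
    Finset.sum_congr rfl fun k hk => by
      rw [inputAt_loopCode hξ (Finset.mem_range.1 hk), meanSq_smul]]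

lemma errorProb_loopCode_le (hξ : ξ ≠ 0) :
    (loopCode M n a ξ).errorProb α
      ≤ 4 * (M * |ξ| ^ n) ^ 2 * meanSq (loopState α a ξ n : Sample M n → ℝ) := by
  have hsub : {p : Sample M n | (loopCode M n a ξ).dec
      ((loopCode M n a ξ).output p.1 (ma1Noise α p.2)) ≠ p.1}
        ⊆ {p | 1 ≤ 4 * (M * |ξ| ^ n) ^ 2 * loopState α a ξ n p ^ 2} := fun p hp => by
    have hhalf := half_le_of_dec_linearCode_ne (neg_ne_zero.2 (inv_ne_zero hξ)) hp
    rw [inv_neg, inv_inv, abs_neg] at hhalf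
    have hstate := linearState_loopCode (α := α) (a := a) hξ p
    rw [messagePoint] at hstate
    rw [hstate] at hhalf
    have hsq := pow_le_pow_left₀ (by norm_num) hhalf 2
    rw [mul_pow, sq_abs] at hsq
    rw [Set.mem_ofPred_eq]
    linarith
  have hmarkov := mul_meas_ge_le_integral_of_nonneg (μ := messageInnovationLaw M n)
    (ae_of_all _ fun p => by positivity)
    ((memLp_loopState (M := M) (n := n) α a ξ n).integrable_sq.const_mul
      (4 * (M * |ξ| ^ n) ^ 2)) 1
  rw [one_mul, integral_const_mul] at hmarkov
  exact (measureReal_mono hsub).trans hmarkov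

end ClosedLoop

section Achievability

variable {α ξ P : ℝ}

lemma exists_bias_slack (hξ : ξ ^ 2 < 1) (hP : stationaryPower α ξ < P) :
    ∃ t ∈ Set.Ioo (0 : ℝ) 1, ξ ^ 2 / (1 - t) < 1 ∧
      (ξ⁻¹ - α * (1 - t ^ 2)) ^ 2 * ((1 - ξ ^ 2) ^ 2 * (1 + t)) < P * (1 - ξ ^ 2 / (1 - t)) := by
  have hdiv : ContinuousAt (fun t : ℝ => ξ ^ 2 / (1 - t)) 0 := by fun_prop (disch := norm_num)
  have hcontract : ∀ᶠ t : ℝ in 𝓝 0, ξ ^ 2 / (1 - t) < 1 :=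
    hdiv.eventually_lt_const (by simpa using hξ)
  have hpower : ∀ᶠ t : ℝ in 𝓝 0, (ξ⁻¹ - α * (1 - t ^ 2)) ^ 2 * ((1 - ξ ^ 2) ^ 2 * (1 + t))
      < P * (1 - ξ ^ 2 / (1 - t)) := by
    refine ContinuousAt.eventually_lt (by fun_prop)
      (continuousAt_const.mul (continuousAt_const.sub hdiv)) ?_
    have h := mul_lt_mul_of_pos_right hP (sub_pos.2 hξ)
    norm_num [stationaryPower] at h ⊢
    linarith
  have hpos : ∀ᶠ t : ℝ in 𝓝[>] 0, t ∈ Set.Ioo (0 : ℝ) 1 := Ioo_mem_nhdsGT one_pos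
  exact (hpos.and ((hcontract.and hpower).filter_mono nhdsWithin_le_nhds)).exists

lemma bias_sq_le {t : ℝ} (hα : α ^ 2 ≤ 1) (ht : t ∈ Set.Ioo (0 : ℝ) 1) :
    (α * (1 - t ^ 2)) ^ 2 < 1 ∧
      (α - α * (1 - t ^ 2)) ^ 2 ≤ t ^ 2 * (1 - (α * (1 - t ^ 2)) ^ 2) := by
  have ht0 : 0 < t ^ 2 := pow_pos ht.1 2
  have ht1 : t ^ 2 < 1 := pow_lt_one₀ ht.1.le ht.2 two_ne_zero
  have ha : (α * (1 - t ^ 2)) ^ 2 ≤ (1 - t ^ 2) ^ 2 := by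
    rw [mul_pow]
    exact mul_le_of_le_one_left (sq_nonneg _) hα
  have hshrink : (1 - t ^ 2) ^ 2 ≤ 1 - t ^ 2 :=
    pow_le_of_le_one (sub_nonneg.2 ht1.le) (by linarith) two_ne_zero
  refine ⟨by linarith, ?_⟩
  calc (α - α * (1 - t ^ 2)) ^ 2 = α ^ 2 * (t ^ 2 * t ^ 2) := by ring
    _ ≤ 1 * (t ^ 2 * t ^ 2) := by gcongr
    _ = t ^ 2 * t ^ 2 := one_mul _
    _ ≤ t ^ 2 * (1 - (α * (1 - t ^ 2)) ^ 2) := by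
      gcongr
      linarith

lemma exists_code_errorProb_le (hα : |α| ≤ 1) (hξ0 : ξ ≠ 0) (hξ : |ξ| < 1)
    (hP : stationaryPower α ξ < P) :
    ∃ K : ℝ, 0 ≤ K ∧ ∀ᶠ n : ℕ in atTop, ∀ (M : ℕ) [NeZero M], ∃ c : FeedbackCode M n,
      c.SatisfiesPower α P ∧ c.errorProb α ≤ K * ((n + 1) * (M * |ξ| ^ n) ^ 2) := by
  have hα' : α ^ 2 ≤ 1 := (sq_le_one_iff_abs_le_one α).2 hα
  have hξ' : ξ ^ 2 < 1 := (sq_lt_one_iff_abs_lt_one ξ).2 hξ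
  have hP0 : 0 ≤ P := (mul_nonneg (sq_nonneg _) (sub_nonneg.2 hξ'.le)).trans hP.le
  obtain ⟨t, ht, hcontract, hslack⟩ := exists_bias_slack hξ' hP
  obtain ⟨ha, hbias⟩ := bias_sq_le hα' ht
  set a := α * (1 - t ^ 2)
  set κ := (1 - ξ ^ 2) ^ 2 * (1 + t)
  set K₀ := 1 + 2 * ((1 - ξ ^ 2) ^ 2 / (t * (1 - a ^ 2)))
  set γ := 1 - ξ ^ 2 / (1 - t)
  have hγ : 0 < γ := sub_pos.2 hcontract
  have hκ : 0 ≤ κ := mul_nonneg (sq_nonneg _) (by linarith [ht.1])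
  have hK₀ : 0 ≤ K₀ := add_nonneg zero_le_one (mul_nonneg zero_le_two
    (div_nonneg (sq_nonneg _) (mul_pos ht.1 (sub_pos.2 ha)).le))
  have hlarge : ∀ᶠ n : ℕ in atTop, (ξ⁻¹ - a) ^ 2 * K₀ ≤ n * (P * γ - (ξ⁻¹ - a) ^ 2 * κ) :=
    (tendsto_natCast_atTop_atTop.atTop_mul_const (sub_pos.2 hslack)).eventually_ge_atTop _
  refine ⟨4 * (K₀ + κ), by positivity, hlarge.mono fun n hn M _ => ⟨loopCode M n a ξ, ?_, ?_⟩⟩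
  all_goals
    have hsum := sum_meanSq_loopState_le (M := M) (n := n) (ξ := ξ) hα' ha ht.1 ht.2 hbias
    set S := ∑ k ∈ Finset.range n, meanSq (loopState α a ξ k : Sample M n → ℝ)
    set D := meanSq (loopState α a ξ n : Sample M n → ℝ)
  · have hD : 0 ≤ D := meanSq_nonneg _
    refine (loopCode_satisfiesPower_iff hξ0 hP0).2 (le_of_mul_le_mul_left ?_ hγ)
    calc γ * ((ξ⁻¹ - a) ^ 2 * S) = (ξ⁻¹ - a) ^ 2 * (γ * S) := by ring
      _ ≤ (ξ⁻¹ - a) ^ 2 * (K₀ + n * κ) := by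
        gcongr
        linarith
      _ ≤ γ * (n * P) := by linarith
  · have hS : 0 ≤ γ * S := mul_nonneg hγ.le (Finset.sum_nonneg fun _ _ => meanSq_nonneg _)
    have hnK₀ : 0 ≤ n * K₀ := mul_nonneg n.cast_nonneg hK₀
    calc (loopCode M n a ξ).errorProb α ≤ 4 * (M * |ξ| ^ n) ^ 2 * D := errorProb_loopCode_le hξ0
      _ ≤ 4 * (M * |ξ| ^ n) ^ 2 * ((K₀ + κ) * (n + 1)) := by
        gcongr
        linarith
      _ = 4 * (K₀ + κ) * ((n + 1) * (M * |ξ| ^ n) ^ 2) := by ring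

end Achievability

/-! ### Capacity -/

/-- The channel reliably transmits at rate `R`: codes of every rate up to `R` that meet the power
constraint have error probabilities bounded by a common null sequence. -/
def IsAchievableRate (α P R : ℝ) : Prop :=
  ∃ b : ℕ → ℝ, Tendsto b atTop (𝓝 0) ∧ ∀ᶠ n in atTop, ∀ R' ≤ R,
    ∃ c : FeedbackCode (numMessages n R') n, c.SatisfiesPower α P ∧ c.errorProb α ≤ b n

/-- The channel is unreliable from the rate `R` on: the error probabilities of all codes of rate at
least `R` that meet the power constraint have a common positive lower bound. -/
def IsUnattainableRate (α P R : ℝ) : Prop :=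
  ∃ δ : ℝ, 0 < δ ∧ ∀ n, 1 ≤ n → ∀ R', R ≤ R' →
    ∀ c : FeedbackCode (numMessages n R') n, c.SatisfiesPower α P → δ ≤ c.errorProb α

section Capacity

variable {α P R R' C : ℝ}

instance (n : ℕ) (R : ℝ) : NeZero (numMessages n R) :=
  ⟨(Nat.ceil_pos.2 (Real.rpow_pos_of_pos two_pos _)).ne'⟩

lemma mul_log_two_le_log_numMessages (n : ℕ) (R : ℝ) :
    n * (R * Real.log 2) ≤ Real.log (numMessages n R) := by
  rw [← mul_assoc, ← Real.log_rpow two_pos]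
  exact Real.log_le_log (Real.rpow_pos_of_pos two_pos _) (Nat.le_ceil _)

lemma numMessages_le_two_mul_pow (n : ℕ) (hR : 0 ≤ R) (h : R' ≤ R) :
    (numMessages n R' : ℝ) ≤ 2 * ((2 : ℝ) ^ R) ^ n :=
  calc (numMessages n R' : ℝ) ≤ 2 ^ (n * R') + 1 :=
        (Nat.ceil_lt_add_one (Real.rpow_nonneg zero_le_two _)).le
    _ ≤ 2 ^ (n * R) + 2 ^ (n * R) := by
      gcongr
      · exact one_le_two
      · exact Real.one_le_rpow one_le_two (by positivity)
    _ = 2 * ((2 : ℝ) ^ R) ^ n := by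
      rw [← two_mul, mul_comm (n : ℝ), Real.rpow_mul_natCast zero_le_two]

lemma exists_satisfiesPower (M n : ℕ) [NeZero M] (α P : ℝ) :
    ∃ c : FeedbackCode M n, c.SatisfiesPower α P :=
  ⟨linearCode M n 0 0 0 0, by simp [FeedbackCode.SatisfiesPower, input_linearCode]⟩

lemma IsAchievableRate.mono (h : IsAchievableRate α P R) (hR : R' ≤ R) :
    IsAchievableRate α P R' :=
  let ⟨b, hb, hc⟩ := h
  ⟨b, hb, hc.mono fun _ hn S hS => hn S (hS.trans hR)⟩

lemma IsAchievableRate.exists_codes (h : IsAchievableRate α P R) (S : ℕ → ℝ) :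
    ∃ c : (n : ℕ) → FeedbackCode (numMessages n (S n)) n, (∀ n, (c n).SatisfiesPower α P) ∧
      Tendsto (fun n => (c n).errorProb α) (atTop ⊓ 𝓟 {n | S n ≤ R}) (𝓝 0) := by
  obtain ⟨b, hb, hcodes⟩ := h
  have hex : ∀ n, ∃ c : FeedbackCode (numMessages n (S n)) n, c.SatisfiesPower α P ∧
      ((∃ c' : FeedbackCode (numMessages n (S n)) n, c'.SatisfiesPower α P ∧
        c'.errorProb α ≤ b n) → c.errorProb α ≤ b n) := fun n => by
    by_cases hn : ∃ c' : FeedbackCode (numMessages n (S n)) n,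
        c'.SatisfiesPower α P ∧ c'.errorProb α ≤ b n
    · exact hn.imp fun c hc => ⟨hc.1, fun _ => hc.2⟩
    · exact (exists_satisfiesPower _ n α P).imp fun c hc => ⟨hc, fun h => absurd h hn⟩
  choose c hpower herror using hex
  refine ⟨c, hpower, squeeze_zero' (.of_forall fun n => measureReal_nonneg) ?_
    (hb.mono_left inf_le_left)⟩
  exact eventually_inf_principal.2 (hcodes.mono fun n hn hS => herror n (hn _ hS))

theorem isFeedbackCapacity_of_forall_rate (hlt : ∀ R < C, IsAchievableRate α P R)
    (hgt : ∀ R > C, IsUnattainableRate α P R) : IsFeedbackCapacity α P C := by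
  refine ⟨⟨fun _ => C, fun ε hε => ?_, fun ε hε c hc => ?_⟩, fun S hS =>
    tendsto_order.2 ⟨fun r hr => ?_, fun r hr => ?_⟩⟩
  · obtain ⟨c, hpower, herror⟩ := (hlt (C - ε) (sub_lt_self C hε)).exists_codes fun _ => C - ε
    exact ⟨c, fun n _ => hpower n, by simpa using herror⟩
  · obtain ⟨δ, hδ, h⟩ := hgt (C + ε) (lt_add_of_pos_right C hε)
    exact ⟨δ, hδ, fun n hn => h n hn _ le_rfl (c n) (hc n hn)⟩
  · obtain ⟨R, hrR, hRC⟩ := exists_between hr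
    obtain ⟨c, hpower, herror⟩ := (hlt R hRC).exists_codes fun n => S n + (R - r)
    obtain ⟨δ, hδ, hlower⟩ := hS.2 (R - r) (sub_pos.2 hrR) c fun n _ => hpower n
    filter_upwards [eventually_inf_principal.1 (herror.eventually_lt_const hδ),
      eventually_ge_atTop 1] with n hupper hn
    contrapose! hupper
    exact ⟨by linarith, hlower n hn⟩
  · obtain ⟨R, hCR, hRr⟩ := exists_between hr
    obtain ⟨δ, hδ, hlower⟩ := hgt R hCR
    obtain ⟨c, hpower, herror⟩ := hS.1 (r - R) (sub_pos.2 hRr)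
    filter_upwards [herror.eventually_lt_const hδ, eventually_ge_atTop 1] with n hupper hn
    contrapose! hupper
    exact hlower n hn _ (by linarith) (c n) (hpower n hn)

lemma isAchievableRate_of_two_rpow_mul_lt_one {ξ : ℝ} (hα : |α| ≤ 1) (hξ0 : ξ ≠ 0) (hR0 : 0 ≤ R)
    (hR : 2 ^ R * |ξ| < 1) (hP : stationaryPower α ξ < P) : IsAchievableRate α P R := by
  have hξ : |ξ| < 1 :=
    (le_mul_of_one_le_left (abs_nonneg ξ) (Real.one_le_rpow one_le_two hR0)).trans_lt hR
  obtain ⟨K, hK, hcodes⟩ := exists_code_errorProb_le hα hξ0 hξ hP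
  set q := (2 ^ R * |ξ|) ^ 2
  have hq0 : 0 ≤ q := sq_nonneg _
  have hq1 : q < 1 := pow_lt_one₀ (by positivity) hR two_ne_zero
  refine ⟨fun n => 4 * K * (n * q ^ n + q ^ n), ?_, hcodes.mono fun n hn R' hR' => ?_⟩
  · simpa using ((tendsto_self_mul_const_pow_of_lt_one hq0 hq1).add
      (tendsto_pow_atTop_nhds_zero_of_lt_one hq0 hq1)).const_mul (4 * K)
  · obtain ⟨c, hpower, herror⟩ := hn (numMessages n R')
    refine ⟨c, hpower, herror.trans ?_⟩
    calc K * ((n + 1) * (numMessages n R' * |ξ| ^ n) ^ 2)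
        ≤ K * ((n + 1) * (2 * ((2 : ℝ) ^ R) ^ n * |ξ| ^ n) ^ 2) := by
          gcongr
          exact numMessages_le_two_mul_pow n hR0 hR'
      _ = 4 * K * (n * q ^ n + q ^ n) := by
          simp only [q]
          ring

lemma exists_abs_eq_stationaryPower_eq (α : ℝ) {x : ℝ} (hx : 0 ≤ x) :
    ∃ ξ, |ξ| = x ∧ stationaryPower α ξ = stationaryPower |α| x := by
  rcases abs_choice α with h | h
  · exact ⟨x, abs_of_nonneg hx, by rw [h]⟩
  · exact ⟨-x, by rw [abs_neg, abs_of_nonneg hx], by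
      rw [h, ← stationaryPower_neg_neg, neg_neg]⟩

lemma isAchievableRate_of_lt_neg_logb {x : ℝ} (hα : |α| ≤ 1) (hx : 0 < x) (hx1 : x < 1)
    (hR : R < -Real.logb 2 x) : IsAchievableRate α (stationaryPower |α| x) R := by
  have hR₀ : max R 0 < Real.logb 2 x⁻¹ := by
    rw [Real.logb_inv]
    exact max_lt hR (neg_pos.2 (Real.logb_neg one_lt_two hx hx1))
  rw [Real.lt_logb_iff_rpow_lt one_lt_two (inv_pos.2 hx)] at hR₀
  have hpow : (0 : ℝ) < 2 ^ max R 0 := Real.rpow_pos_of_pos two_pos _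
  obtain ⟨y, hxy, hy⟩ := exists_between (lt_min hx1 ((lt_inv_comm₀ hpow hx).1 hR₀))
  obtain ⟨hy1, hyR⟩ := lt_min_iff.1 hy
  have hy0 : 0 < y := hx.trans hxy
  obtain ⟨ξ, hξ, hpower⟩ := exists_abs_eq_stationaryPower_eq α hy0.le
  refine (isAchievableRate_of_two_rpow_mul_lt_one hα (abs_pos.1 (hξ ▸ hy0)) (le_max_right R 0)
    ?_ ?_).mono (le_max_left R 0)
  · rw [hξ]
    exact (lt_inv_mul_iff₀ hpow).1 (by rwa [mul_one])
  · rw [hpower]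
    exact stationaryPower_strictAntiOn hα ⟨hx, hx1⟩ ⟨hy0, hy1⟩ hxy

lemma isUnattainableRate_of_neg_logb_lt {x : ℝ} (hα : |α| ≤ 1) (hx : 0 < x) (hx1 : x < 1)
    (hR : -Real.logb 2 x < R) : IsUnattainableRate α (stationaryPower |α| x) R := by
  set E := R * Real.log 2 + Real.log x with hEdef
  have hlog2 : 0 < Real.log 2 := Real.log_pos one_lt_two
  have hE : 0 < E := by
    rw [Real.logb, ← neg_div, div_lt_iff₀ hlog2] at hR
    linarith
  have hlogx : Real.log x < 0 := Real.log_neg hx hx1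
  have hexp : Real.log (1 - Real.exp (-(E / 2))) < 0 :=
    Real.log_neg (sub_pos.2 (Real.exp_lt_one_iff.2 (by linarith))) (sub_lt_self 1 (Real.exp_pos _))
  refine ⟨E / 2 / (-Real.log x + E - Real.log (1 - Real.exp (-(E / 2)))),
    div_pos (half_pos hE) (by linarith), fun n hn R' hRR' c hc =>
      hc.div_le_errorProb hx hx1 ((mul_le_of_le_one_left hx.le hα).trans_lt hx1) hn hE ?_⟩
  calc n * (-Real.log x + E) = n * (R * Real.log 2) := by
        rw [hEdef]
        ring
    _ ≤ n * (R' * Real.log 2) := by gcongr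
    _ ≤ Real.log (numMessages n R') := mul_log_two_le_log_numMessages n R'

theorem isFeedbackCapacity_stationaryPower {x : ℝ} (hα : |α| ≤ 1) (hx : 0 < x) (hx1 : x < 1) :
    IsFeedbackCapacity α (stationaryPower |α| x) (-Real.logb 2 x) :=
  isFeedbackCapacity_of_forall_rate (fun _ => isAchievableRate_of_lt_neg_logb hα hx hx1)
    fun _ => isUnattainableRate_of_neg_logb_lt hα hx hx1

end Capacity

end GaussianFeedback

end

theorem theorem1 (α P : ℝ) (hα : |α| ≤ 1) (hP : 0 < P) :
    ∃ x₀ : ℝ,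
      (0 < x₀ ∧ P * x₀ ^ 2 = (1 - x₀ ^ 2) * (1 - |α| * x₀) ^ 2) ∧
      (∀ x : ℝ, 0 < x → P * x ^ 2 = (1 - x ^ 2) * (1 - |α| * x) ^ 2 → x = x₀) ∧
      GaussianFeedback.IsFeedbackCapacity α P (-Real.logb 2 x₀) := by
  obtain ⟨x₀, hx₀, rfl⟩ := GaussianFeedback.exists_stationaryPower_eq |α| hP
  refine ⟨x₀, ⟨hx₀.1, (GaussianFeedback.stationaryPower_eq_iff hx₀.1.ne').1 rfl⟩,
    fun x hx hroot => ?_, GaussianFeedback.isFeedbackCapacity_stationaryPower hα hx₀.1 hx₀.2⟩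
  have hpower := (GaussianFeedback.stationaryPower_eq_iff hx.ne').2 hroot
  have hx1 : x < 1 := GaussianFeedback.lt_one_of_stationaryPower_pos (hpower ▸ hP)
  exact (GaussianFeedback.stationaryPower_strictAntiOn hα).injOn ⟨hx, hx1⟩ hx₀ hpower
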